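/- **Setting.** Let $v_\pm\in\ell^1(\mathbb Z^2,\mathbb R)$ be functions of positive type (their Fourier transforms $\hat v_\pm(k)=\sum_x e^{-ik\cdot x}v_\pm(x)$ are non-negative) such that $\hat v_+\hat v_-=0$, and let $v:=v_+-v_-$ (so $\hat v_\pm$ are the positive and negative parts of $\hat v$, and $\hat v_++\hat v_-=|\hat v|$). Assume $v(x)=v(-x)$ and $v(x_1,x_2)=v(-x_2,x_1)$. Let $\kappa>0$ and $h_b\ge 0$. On the tensor product of the fermionic (spin $\tfrac12$) and the bosonic (spinless) Fock space over $\mathbb Z^2$, with annihilation operators $a_{x,\mathrm s}$ and $b_x$, $n_{x,\mathrm s}:=a_{x,\mathrm s}^*a_{x,\mathrm s}$ and $c_x:=\sum_{|z|\le 1}e^{-\kappa|z|}a_{x+z,\uparrow}a_{x,\downarrow}$, consider for $\epsilon,U>0$ $$\mathbf H=H_f+\epsilon h_b\Big(-\tfrac12\sum_{|x-y|=1}b_x^*b_y+2\sum_x b_x^*b_x\Big)+\sum_{x,y}v(x-y)\,(b_x^*c_y+c_y^*b_x),$$ $$H_f=\epsilon\Big(-\tfrac12\sum_{\mathrm s,\,|x-y|=1}a_{x,\mathrm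 s}^*a_{y,\mathrm s}+2\sum_{\mathrm s,x}a_{x,\mathrm s}^*a_{x,\mathrm s}\Big)+U\sum_x n_{x,\uparrow}n_{x,\downarrow},$$ and the uncoupled model $$\tilde{\mathbf H}=H_f-\sum_{x,y\in\mathbb Z^2}w_f(x-y)\,c_x^*c_y-\sum_{x,y\in\mathbb Z^2}w_b(x-y)\,b_x^*b_y,$$ $$w_b=\gamma_b(v_++v_-)+\tfrac1{2U}\,v*v,\qquad w_f=\gamma_f(v_++v_-)-\tfrac{\gamma_f^2}{2U+1}\,v*v.$$ Let $H^{(2,1)}$ and $\tilde H^{(2,1)}$ be the restrictions of $\mathbf H$ and $\tilde{\mathbf H}$ to the sector $\ell^2(\mathbb Z^2\times\mathbb Z^2)\oplus\ell^2(\mathbb Z^2)$ of either one fermion pair with opposite spins (and no boson) or one boson (and no fermion), and let $E_0:=\inf\sigma(H^{(2,1)})$. **Theorem 4.1 (Effectiveness of the uncoupled model).** Set $\gamma_b:=2e^{-\kappa}$ and $\gamma_f:=\gamma_b^{-1}$. There are $\varepsilon_0>0$ and $C<\infty$, depending only on $v_\pm,\kappa,h_b$, such that for all hopping strengths $\epsilon>0$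 and all $U>0$ the restrictions $H^{(2,1)}$ and $\tilde H^{(2,1)}$ are well-defined bounded self-adjoint operators and, for all $\varepsilon\in(0,\varepsilon_0)$ and $t\in\mathbb R$, $$\Big\|\big(e^{-itH^{(2,1)}}-e^{-it\tilde H^{(2,1)}}\big)\,\mathbf 1_{[E_0,\,E_0(1-\varepsilon)]}(H^{(2,1)})\Big\|_{\mathrm{op}}\le C\,(1+|t|)\,(\epsilon+U^{-2}).$$ -/

import Mathlib

open scoped lp

namespace BipolaronModel

/-! ### The lattice -/

/-- The square lattice `ℤ²`. -/
abbrev Site := ℤ × ℤ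

/-- The Euclidean norm of a lattice point. -/
noncomputable def siteNorm (x : Site) : ℝ := Real.sqrt ((x.1 : ℝ) ^ 2 + (x.2 : ℝ) ^ 2)

/-- The lattice points of Euclidean norm at most `1` (see `mem_unitBall`). -/
def unitBall : Finset Site := {(0, 0), (1, 0), (-1, 0), (0, 1), (0, -1)}

theorem mem_unitBall (z : Site) : z ∈ unitBall ↔ siteNorm z ≤ 1 := by
  obtain ⟨a, b⟩ := z
  unfold siteNorm
  rw [Real.sqrt_le_iff, one_pow, and_iff_right zero_le_one]
  have key : ((a : ℝ) ^ 2 + (b : ℝ) ^ 2 ≤ 1) ↔ a ^ 2 + b ^ 2 ≤ 1 := by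
    rw [← @Int.cast_le ℝ]
    push_cast
    exact Iff.rfl
  simp only [key, unitBall, Finset.mem_insert, Finset.mem_singleton, Prod.mk.injEq]
  constructor
  · rintro (⟨rfl, rfl⟩ | ⟨rfl, rfl⟩ | ⟨rfl, rfl⟩ | ⟨rfl, rfl⟩ | ⟨rfl, rfl⟩) <;> norm_num
  · intro h
    have ha1 : a ≤ 1 := by nlinarith [sq_nonneg b]
    have ha2 : -1 ≤ a := by nlinarith [sq_nonneg b]
    have hb1 : b ≤ 1 := by nlinarith [sq_nonneg a]
    have hb2 : -1 ≤ b := by nlinarith [sq_nonneg a]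
    interval_cases a <;> interval_cases b <;> simp_all

/-- Ordered pairs of nearest neighbours of the lattice. -/
abbrev NNPair := {p : Site × Site // siteNorm (p.1 - p.2) = 1}

/-- The Fourier transform of a summable function on the lattice, at the quasi-momentum `k`. -/
noncomputable def fourier (f : Site → ℝ) (k : ℝ × ℝ) : ℂ :=
  ∑' x : Site, Complex.exp (-(Complex.I * ((k.1 * x.1 + k.2 * x.2 : ℝ) : ℂ))) * (f x : ℂ)

/-- A function of positive type: its Fourier transform is real and non-negative. -/
def IsPositiveType (f : Site → ℝ) : Prop :=
  ∀ k : ℝ × ℝ, 0 ≤ (fourier f k).re ∧ (fourier f k).im = 0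

/-- Convolution of functions on the lattice. -/
noncomputable def conv (f g : Site → ℝ) (x : Site) : ℝ := ∑' y : Site, f (x - y) * g y

/-! ### Fock space -/

/-- The two spin states of a fermion. -/
inductive Spin
  | up
  | down
  deriving DecidableEq

/-- One-fermion modes: a lattice site and a spin. -/
abbrev Mode := Site × Spin

/-- Families of wave functions of `m` fermions (spin 1/2) and `n` bosons (spinless) on the lattice.
The Fock space `𝓕₋ ⊗ 𝓕₊` consists of the square-summable families that are antisymmetric in the
fermionic and symmetric in the bosonic variables. The operators below are given by their action on
wave functions; on (anti)symmetric ones these are the usual creation and annihilation operators. -/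
abbrev FockFn := (m n : ℕ) → (Fin m → Mode) → (Fin n → Site) → ℂ

/-- The fermionic annihilation operator `a_x`. -/
noncomputable def annF (x : Mode) (ψ : FockFn) : FockFn :=
  fun m n y z => (Real.sqrt (m + 1) : ℂ) * ψ (m + 1) n (Fin.cons x y) z

/-- The fermionic creation operator `a_x^*`. -/
noncomputable def creF (x : Mode) (ψ : FockFn) : FockFn
  | 0, _, _, _ => 0
  | m + 1, n, y, z =>
      (Real.sqrt (m + 1) : ℂ)⁻¹ *
        ∑ j : Fin (m + 1),
          if y j = x then (-1 : ℂ) ^ (j : ℕ) * ψ m n (j.removeNth y) z else 0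

/-- The bosonic annihilation operator `b_x`. -/
noncomputable def annB (x : Site) (ψ : FockFn) : FockFn :=
  fun m n y z => (Real.sqrt (n + 1) : ℂ) * ψ m (n + 1) y (Fin.cons x z)

/-- The bosonic creation operator `b_x^*`. -/
noncomputable def creB (x : Site) (ψ : FockFn) : FockFn
  | _, 0, _, _ => 0
  | m, n + 1, y, z =>
      (Real.sqrt (n + 1) : ℂ)⁻¹ *
        ∑ j : Fin (n + 1), if z j = x then ψ m n y (j.removeNth z) else 0

/-- The number operator `n_x = a_x^* a_x`. -/
noncomputable def numF (x : Mode) (ψ : FockFn) : FockFn := creF x (annF x ψ)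

/-- The (infinite) sum of a family of operators, computed on the values of wave functions. For all
families used below, this sum converges absolutely on square-summable wave functions. -/
noncomputable def opSum {ι : Type} (T : ι → FockFn → FockFn) (ψ : FockFn) : FockFn :=
  fun m n y z => ∑' i : ι, T i ψ m n y z

/-- The pair annihilation operator `c_x = ∑_{|z| ≤ 1} e^{-κ|z|} a_{x+z,↑} a_{x,↓}`. -/
noncomputable def pairAnn (κ : ℝ) (x : Site) (ψ : FockFn) : FockFn :=
  ∑ z ∈ unitBall, Real.exp (-κ * siteNorm z) • annF (x + z, Spin.up) (annF (x, Spin.down) ψ)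

/-- Its adjoint `c_x^* = ∑_{|z| ≤ 1} e^{-κ|z|} a_{x,↓}^* a_{x+z,↑}^*`. -/
noncomputable def pairCre (κ : ℝ) (x : Site) (ψ : FockFn) : FockFn :=
  ∑ z ∈ unitBall, Real.exp (-κ * siteNorm z) • creF (x, Spin.down) (creF (x + z, Spin.up) ψ)

/-! ### The Hamiltonians -/

/-- The Hubbard Hamiltonian `H_f` of the fermions, with hopping `hop` and on-site repulsion `U`. -/
noncomputable def fermionH (hop U : ℝ) (ψ : FockFn) : FockFn :=
  hop • (-(1 / 2 : ℝ) •
        opSum (fun i : Spin × NNPair =>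
          fun φ => creF (i.2.1.1, i.1) (annF (i.2.1.2, i.1) φ)) ψ
      + (2 : ℝ) • opSum (fun i : Spin × Site => numF (i.2, i.1)) ψ)
    + U • opSum (fun x : Site => fun φ => numF (x, Spin.up) (numF (x, Spin.down) φ)) ψ

/-- The kinetic energy `H_b` of the bosons. -/
noncomputable def bosonH (hop hb : ℝ) (ψ : FockFn) : FockFn :=
  hop • (-(hb / 2) • opSum (fun p : NNPair => fun φ => creB p.1.1 (annB p.1.2 φ)) ψ
      + (2 * hb) • opSum (fun x : Site => fun φ => creB x (annB x φ)) ψ)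

/-- The exchange interaction `W = ∑_{x,y} v(x - y) (b_x^* c_y + c_y^* b_x)`. -/
noncomputable def exchangeW (κ : ℝ) (v : Site → ℝ) (ψ : FockFn) : FockFn :=
  opSum (fun p : Site × Site => fun φ =>
    v (p.1 - p.2) • (creB p.1 (pairAnn κ p.2 φ) + pairCre κ p.2 (annB p.1 φ))) ψ

/-- The boson-fermion Hamiltonian `𝐇 = H_f + H_b + W`. -/
noncomputable def fullH (hop U hb κ : ℝ) (v : Site → ℝ) (ψ : FockFn) : FockFn :=
  fermionH hop U ψ + bosonH hop hb ψ + exchangeW κ v ψ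

/-- The effective hopping `w_b = γ_b (v₊ + v₋) + (2U)⁻¹ v * v`, where `v = v₊ - v₋`. -/
noncomputable def kernelB (γb U : ℝ) (vp vm : Site → ℝ) (x : Site) : ℝ :=
  γb * (vp x + vm x) + 1 / (2 * U) * conv (vp - vm) (vp - vm) x

/-- The BCS kernel `w_f = γ_f (v₊ + v₋) - γ_f² (2U + 1)⁻¹ v * v`, where `v = v₊ - v₋`. -/
noncomputable def kernelF (γf U : ℝ) (vp vm : Site → ℝ) (x : Site) : ℝ :=
  γf * (vp x + vm x) - γf ^ 2 / (2 * U + 1) * conv (vp - vm) (vp - vm) x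

/-- The free boson Hamiltonian `-∑_{x,y} w(x - y) b_x^* b_y`. -/
noncomputable def effBosonH (w : Site → ℝ) (ψ : FockFn) : FockFn :=
  -opSum (fun p : Site × Site => fun φ => w (p.1 - p.2) • creB p.1 (annB p.2 φ)) ψ

/-- The BCS-like fermion Hamiltonian `H_f - ∑_{x,y} w(x - y) c_x^* c_y`. -/
noncomputable def effFermionH (hop U κ : ℝ) (w : Site → ℝ) (ψ : FockFn) : FockFn :=
  fermionH hop U ψ -
    opSum (fun p : Site × Site => fun φ => w (p.1 - p.2) • pairCre κ p.1 (pairAnn κ p.2 φ)) ψ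

/-- The uncoupled effective model `𝐇̃ = H̃_f + H̃_b`. -/
noncomputable def uncoupledH (hop U κ γb γf : ℝ) (vp vm : Site → ℝ) (ψ : FockFn) : FockFn :=
  effFermionH hop U κ (kernelF γf U vp vm) ψ + effBosonH (kernelB γb U vp vm) ψ

/-! ### The sector of one zero-spin fermion pair or one boson -/

/-- The Hilbert space `ℓ²(ℤ² × ℤ²) ⊕ ℓ²(ℤ²)` of pairs `(𝔠, 𝔟)`: the wave function `𝔠 (x↑, x↓)` of a
pair of fermions with opposite spins, and the wave function `𝔟` of a boson. -/
def Sector : Type := WithLp 2 (ℓ²(Site × Site, ℂ) × ℓ²(Site, ℂ))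

noncomputable instance : NormedAddCommGroup Sector :=
  inferInstanceAs (NormedAddCommGroup (WithLp 2 (ℓ²(Site × Site, ℂ) × ℓ²(Site, ℂ))))

noncomputable instance : InnerProductSpace ℂ Sector :=
  inferInstanceAs (InnerProductSpace ℂ (WithLp 2 (ℓ²(Site × Site, ℂ) × ℓ²(Site, ℂ))))

instance : CompleteSpace Sector :=
  inferInstanceAs (CompleteSpace (WithLp 2 (ℓ²(Site × Site, ℂ) × ℓ²(Site, ℂ))))

/-- The fermion pair component `𝔠` of a vector of the sector. -/
def pairPart (ψ : Sector) : ℓ²(Site × Site, ℂ) := (WithLp.ofLp ψ).1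

/-- The boson component `𝔟` of a vector of the sector. -/
def bosonPart (ψ : Sector) : ℓ²(Site, ℂ) := (WithLp.ofLp ψ).2

/-- The canonical isometric embedding of the sector into Fock space, normalized so that
`a_{x,↑} a_{y,↓} (𝔠) = 𝔠 (x, y)` (see `annF_annF_embed`). -/
noncomputable def embed (ψ : Sector) : FockFn
  | 2, 0, y, _ =>
      match y 0, y 1 with
      | (x₀, Spin.down), (x₁, Spin.up) => (Real.sqrt 2 : ℂ)⁻¹ * pairPart ψ (x₁, x₀)
      | (x₀, Spin.up), (x₁, Spin.down) => -((Real.sqrt 2 : ℂ)⁻¹ * pairPart ψ (x₀, x₁))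
      | _, _ => 0
  | 0, 1, _, z => bosonPart ψ (z 0)
  | _, _, _, _ => 0

theorem annF_annF_embed (ψ : Sector) (x y : Site) (p : Fin 0 → Mode) (q : Fin 0 → Site) :
    annF (x, Spin.up) (annF (y, Spin.down) (embed ψ)) 0 0 p q = pairPart ψ (x, y) := by
  have h2 : (Real.sqrt 2 : ℂ) ≠ 0 := by
    exact_mod_cast (Real.sqrt_pos.2 (by norm_num : (0 : ℝ) < 2)).ne'
  simp [annF, embed, one_add_one_eq_two, h2]

theorem annB_embed (ψ : Sector) (x : Site) (p : Fin 0 → Mode) (q : Fin 0 → Site) :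
    annB x (embed ψ) 0 0 p q = bosonPart ψ x := by
  simp [annB, embed]

/-- The bounded operator `T` on the sector is the restriction to it of the Fock space operator `G`
(in particular, `G` leaves the sector invariant). -/
def IsSectorRestriction (G : FockFn → FockFn) (T : Sector →L[ℂ] Sector) : Prop :=
  ∀ ψ : Sector, embed (T ψ) = G (embed ψ)

theorem embed_injective : Function.Injective embed := by
  intro ψ φ h
  refine (WithLp.ofLp_injective 2) (Prod.ext ?_ ?_)
  · ext ⟨x, y⟩
    have := congrArg (fun f => annF (x, Spin.up) (annF (y, Spin.down) f) 0 0 finZeroElim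
      finZeroElim) h
    simp only [annF_annF_embed] at this
    exact this
  · ext x
    have := congrArg (fun f => annB x f 0 0 finZeroElim finZeroElim) h
    simp only [annB_embed] at this
    exact this

/-- The restriction to the sector is unique. -/
theorem IsSectorRestriction.unique {G : FockFn → FockFn} {S T : Sector →L[ℂ] Sector}
    (hS : IsSectorRestriction G S) (hT : IsSectorRestriction G T) : S = T :=
  ContinuousLinearMap.ext fun ψ => embed_injective ((hS ψ).trans (hT ψ).symm)

/-! ### Spectral projections -/

section Spectral

variable {E : Type*} [NormedAddCommGroup E] [InnerProductSpace ℂ E] [CompleteSpace E]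

/-- The spectral subspace of a bounded self-adjoint operator `A` for the interval `[a, b]`: the
vectors `ψ` whose spectral measure is carried by `[a, b]`, that is, `f(A) ψ = 0` for all continuous
functions `f` that vanish on `[a, b]` (recall that `‖f(A) ψ‖² = ∫ f² dμ_ψ`). -/
noncomputable def spectralSubspace (A : E →L[ℂ] E) (a b : ℝ) : Submodule ℂ E :=
  ⨅ f : {f : C(ℝ, ℝ) // ∀ x ∈ Set.Icc a b, f x = 0}, (cfc (f.1 : ℝ → ℝ) A).ker

theorem isClosed_spectralSubspace (A : E →L[ℂ] E) (a b : ℝ) :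
    IsClosed (spectralSubspace A a b : Set E) := by
  rw [spectralSubspace, Submodule.coe_iInf]
  exact isClosed_iInter fun f => (cfc (f.1 : ℝ → ℝ) A).isClosed_ker

instance (A : E →L[ℂ] E) (a b : ℝ) : (spectralSubspace A a b).HasOrthogonalProjection :=
  haveI : CompleteSpace (spectralSubspace A a b) :=
    (isClosed_spectralSubspace A a b).completeSpace_coe
  inferInstance

/-- The spectral projection `1_{[a, b]}(A)` of a bounded self-adjoint operator `A`: the orthogonal
projection onto its spectral subspace. -/
noncomputable def spectralProjection (A : E →L[ℂ] E) (a b : ℝ) : E →L[ℂ] E :=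
  (spectralSubspace A a b).starProjection

/-- The bottom of the spectrum of `A`. -/
noncomputable def groundEnergy (A : E →L[ℂ] E) : ℝ := sInf (spectrum ℝ A)

/-- The unitary group `e^{-itA}` generated by `A`. -/
noncomputable def propagator (A : E →L[ℂ] E) (t : ℝ) : E →L[ℂ] E :=
  NormedSpace.exp ((-(Complex.I * (t : ℂ))) • A)

end Spectral

end BipolaronModel

namespace BipolaronModel

/-! ### Spectral subspaces, Duhamel's formula and a bound for operator Sylvester equations. -/

section Abstract

open Complex

variable {E K : Type*} [NormedAddCommGroup E] [InnerProductSpace ℂ E] [CompleteSpace E]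
  [NormedAddCommGroup K] [InnerProductSpace ℂ K] [CompleteSpace K]

/-! ### Spectral subspaces -/

/-! On the sector the coupled Hamiltonian is `H = U P*P + c* V B + B* V c + hop T` with `c = P + γ
D`. Here `P`, `D`, `B` read off the doubly occupied, neighbouring-pair and boson amplitudes; they
are adjoints of isometries with orthogonal ranges, and `γ = 2 exp(-κ)`. `V` is convolution by `v`,
and `A`, convolution by `v₊ + v₋`, is its modulus: `A ≥ 0`, `A² = V²`, and `A` commutes with `V`.

By Duhamel's formula it suffices to show `H - H̃ = O(η)`, with `η = hop + U⁻²`, on the spectral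
subspace `S` of `H`, which is invariant under the dynamics. If `η` is not small, the trivial bound 2
is enough. If `V ≠ 0` and `η` is small, a trial state without double occupancy gives an energy below
a negative constant independent of `U`, so `H ≤ -m < 0` on `S`. Dropping `U P*P ≥ 0` bounds `H` from
below independently of `U`, so `‖Hψ‖ ≤ M ‖ψ‖` on `S`. If `V = 0`, then `A = 0` and `H - H̃` is of
order `hop`.

On `S` the `P` component of the eigenvalue-type equations gives `P = -U⁻¹ V B + O(η)`. Eliminating
`P` and `D` leaves `B H² + U⁻¹ V² B H - γ² V² B = O(η)`. Up to `U⁻²` this quadratic in `H` has the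
two roots `-V²/(2U) ± γA`. So `Z = B H + (γA + V²/(2U)) B` satisfies a Sylvester equation `Z H + N Z
= O(η)` with `N = V²/(2U) - γA ≤ m/2`. Negativity of `H` on `S` excludes the other root and forces
`Z = O(η)` (`norm_apply_le_of_sylvester`). This says that the boson component evolves by the
effective hopping. The same follows for `D`, since its defect `R` satisfies `R H = γ V Z + O(η)`.
Substituting into `H - H̃` makes all terms of order 1 and `1/U` cancel (`norm_model_sub_apply_le`).

The facts about `V` and `A` come from Gelfand theory: characters of the commutative C⋆-algebra of
translations are quasi-momenta, so signs and products of Fourier transforms carry over to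
convolution operators. The remaining work is to identify the Fock space operators on the sector. -/

theorem mem_spectralSubspace {A : E →L[ℂ] E} {a b : ℝ} {ψ : E} :
    ψ ∈ spectralSubspace A a b ↔
      ∀ f : ℝ → ℝ, Continuous f → (∀ x ∈ Set.Icc a b, f x = 0) → cfc f A ψ = 0 := by
  simp only [spectralSubspace, Submodule.mem_iInf, Subtype.forall]
  constructor
  · intro h f hf hf0
    exact h ⟨f, hf⟩ hf0
  · intro h f hf0
    exact h f f.continuous hf0

theorem apply_mem_spectralSubspace {A : E →L[ℂ] E} {a b : ℝ} {ψ : E}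
    (hψ : ψ ∈ spectralSubspace A a b) : A ψ ∈ spectralSubspace A a b := by
  rw [mem_spectralSubspace] at hψ ⊢
  intro f hf hf0
  have h : Commute (cfc f A) A := (Commute.refl A).cfc_real f
  have h2 := congrArg (fun T : E →L[ℂ] E => T ψ) h.eq
  simp only [mul_apply_eq_comp] at h2
  rw [h2, hψ f hf hf0, map_zero]

/-- The identity and its truncation to `[a, b]` differ by a function vanishing on `[a, b]`. The
truncated function is bounded globally, so norm and form bounds on the subspace follow from the
functional calculus without spectral measures. -/
theorem apply_eq_cfc_clamp {A : E →L[ℂ] E} (hA : IsSelfAdjoint A) {a b : ℝ} {ψ : E}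
    (hψ : ψ ∈ spectralSubspace A a b) :
    A ψ = cfc (fun x : ℝ => min (max x a) b) A ψ := by
  rw [mem_spectralSubspace] at hψ
  have h := hψ (fun x => x - min (max x a) b) (by fun_prop) (by
    intro x hx
    rw [max_eq_left hx.1, min_eq_left hx.2, sub_self])
  rw [cfc_sub (fun x : ℝ => x) (fun x : ℝ => min (max x a) b) A (by fun_prop) (by fun_prop),
    cfc_id' ℝ A] at h
  simpa [sub_eq_zero] using h

omit [CompleteSpace E] in
theorem re_inner_algebraMap (c : ℝ) (ψ : E) :
    (inner ℂ ψ (algebraMap ℝ (E →L[ℂ] E) c ψ)).re = c * ‖ψ‖ ^ 2 := by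
  rw [Algebra.algebraMap_eq_smul_one, smul_apply, one_apply_eq_self, inner_smul_right_eq_smul,
    inner_self_eq_norm_sq_to_K, Complex.smul_re, smul_eq_mul]
  congr 1
  norm_cast

omit [CompleteSpace E] in
theorem re_inner_le_of_le {A B : E →L[ℂ] E} (h : A ≤ B) (ψ : E) :
    (inner ℂ ψ (A ψ)).re ≤ (inner ℂ ψ (B ψ)).re := by
  have h2 := ((ContinuousLinearMap.le_def _ _).1 h).re_inner_nonneg_right ψ
  rw [sub_apply, inner_sub_right, map_sub] at h2
  exact sub_nonneg.1 h2

theorem norm_apply_le_of_mem_spectralSubspace {A : E →L[ℂ] E} (hA : IsSelfAdjoint A) {a b M : ℝ}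
    (hab : a ≤ b) (ha : -M ≤ a) (hb : b ≤ M) {ψ : E} (hψ : ψ ∈ spectralSubspace A a b) :
    ‖A ψ‖ ≤ M * ‖ψ‖ := by
  rw [apply_eq_cfc_clamp hA hψ]
  refine (ContinuousLinearMap.le_opNorm _ _).trans ?_
  gcongr
  refine norm_cfc_le (by linarith) fun x _ => ?_
  rw [Real.norm_eq_abs, abs_le]
  exact ⟨ha.trans (le_min (le_max_right _ _) hab), (min_le_right _ _).trans hb⟩

theorem re_inner_apply_le_of_mem_spectralSubspace {A : E →L[ℂ] E} (hA : IsSelfAdjoint A) {a b : ℝ}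
    {ψ : E} (hψ : ψ ∈ spectralSubspace A a b) : (inner ℂ ψ (A ψ)).re ≤ b * ‖ψ‖ ^ 2 := by
  rw [apply_eq_cfc_clamp hA hψ, ← re_inner_algebraMap]
  exact re_inner_le_of_le (cfc_le_algebraMap _ b A fun x _ => min_le_right _ _) ψ

theorem le_spectrum_of_le_re_inner {A : E →L[ℂ] E} (hA : IsSelfAdjoint A) {c : ℝ}
    (h : ∀ ψ, c * ‖ψ‖ ^ 2 ≤ (inner ℂ ψ (A ψ)).re) : ∀ x ∈ spectrum ℝ A, c ≤ x := by
  rw [← algebraMap_le_iff_le_spectrum (a := A), ContinuousLinearMap.le_def]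
  refine ContinuousLinearMap.isPositive_def'.2 ⟨hA.sub (IsSelfAdjoint.algebraMap _ (.all c)), ?_⟩
  intro ψ
  rw [ContinuousLinearMap.reApplyInnerSelf_apply, ← inner_re_symm, sub_apply, inner_sub_right,
    map_sub]
  have := h ψ
  rw [← re_inner_algebraMap] at this
  exact sub_nonneg.2 this

theorem le_groundEnergy {A : E →L[ℂ] E} [Nontrivial E] (hA : IsSelfAdjoint A) {c : ℝ}
    (h : ∀ ψ, c * ‖ψ‖ ^ 2 ≤ (inner ℂ ψ (A ψ)).re) : c ≤ groundEnergy A :=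
  le_csInf (ContinuousFunctionalCalculus.spectrum_nonempty A hA) (le_spectrum_of_le_re_inner hA h)

theorem groundEnergy_mul_le {A : E →L[ℂ] E} (hA : IsSelfAdjoint A) (ψ : E) :
    groundEnergy A * ‖ψ‖ ^ 2 ≤ (inner ℂ ψ (A ψ)).re := by
  rw [← re_inner_algebraMap]
  refine re_inner_le_of_le ?_ ψ
  rw [algebraMap_le_iff_le_spectrum (a := A)]
  exact fun x hx => csInf_le (spectrum.isCompact A).bddBelow hx

/-! ### Duhamel's formula -/

theorem propagator_mem_unitary {A : E →L[ℂ] E} (hA : IsSelfAdjoint A) (t : ℝ) :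
    propagator A t ∈ unitary (E →L[ℂ] E) := by
  have h : IsSelfAdjoint ((-t : ℝ) • A) := by
    exact IsSelfAdjoint.smul (.all _) hA
  have := (selfAdjoint.expUnitary ⟨_, h⟩).2
  rw [selfAdjoint.expUnitary_coe] at this
  convert this using 2
  simp [propagator, smul_smul, ← Complex.coe_smul]

theorem norm_propagator_le_one {A : E →L[ℂ] E} (hA : IsSelfAdjoint A) (t : ℝ) :
    ‖propagator A t‖ ≤ 1 := by
  nontriviality (E →L[ℂ] E)
  exact (CStarRing.norm_of_mem_unitary (propagator_mem_unitary hA t)).le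

theorem hasDerivAt_propagator (A : E →L[ℂ] E) (t : ℝ) :
    HasDerivAt (fun s => propagator A s) (propagator A t * ((-I) • A)) t := by
  have e (s : ℝ) : propagator A s = NormedSpace.exp (s • ((-I) • A)) := by
    rw [propagator, ← Complex.coe_smul, smul_smul]
    congr 2
    ring
  simp only [e]
  exact hasDerivAt_exp_smul_const ((-I) • A) (𝕂 := ℝ) t

theorem propagator_mul_propagator_neg (A : E →L[ℂ] E) (t : ℝ) :
    propagator A t * propagator A (-t) = 1 := by
  have hinv : (-(I * ((-t : ℝ) : ℂ))) • A = -((-(I * (t : ℂ))) • A) := by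
    rw [← neg_smul]; congr 1; push_cast; ring
  let _ : NormedAlgebra ℚ (E →L[ℂ] E) := .restrictScalars ℚ ℂ _
  rw [propagator, propagator, hinv, ← NormedSpace.exp_add_of_commute (Commute.neg_right rfl),
    add_neg_cancel, NormedSpace.exp_zero]

theorem propagator_zero (A : E →L[ℂ] E) : propagator A 0 = 1 := by
  simp [propagator]

theorem commute_propagator (A : E →L[ℂ] E) (t : ℝ) : Commute A (propagator A t) :=
  (Commute.smul_right (Commute.refl A) _).exp_right

theorem propagator_apply_mem_spectralSubspace {A : E →L[ℂ] E} {a b : ℝ} (t : ℝ) {ψ : E}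
    (hψ : ψ ∈ spectralSubspace A a b) : propagator A t ψ ∈ spectralSubspace A a b := by
  rw [mem_spectralSubspace] at hψ ⊢
  intro f hf hf0
  have h : Commute (cfc f A) (propagator A t) := (commute_propagator A t).cfc_real f
  have h2 := congrArg (fun T : E →L[ℂ] E => T ψ) h.eq
  simp only [mul_apply_eq_comp] at h2
  rw [h2, hψ f hf hf0, map_zero]

theorem norm_propagator_apply_le {A : E →L[ℂ] E} (hA : IsSelfAdjoint A) (t : ℝ) (ψ : E) :
    ‖propagator A t ψ‖ ≤ ‖ψ‖ := by
  simpa using (propagator A t).le_of_opNorm_le (norm_propagator_le_one hA t) ψ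

/-- Duhamel in interaction form: the derivative of `exp(isG) exp(-isH) ψ` is `-i exp(isG) (H - G)
exp(-isH) ψ`, and the mean value inequality integrates it. Only the orbit of `ψ` under `H` enters.
-/
theorem norm_propagator_sub_apply_le {H G : E →L[ℂ] E} (hG : IsSelfAdjoint G) {r : ℝ} {ψ : E}
    (h : ∀ s, ‖(H - G) (propagator H s ψ)‖ ≤ r) (t : ℝ) :
    ‖(propagator H t - propagator G t) ψ‖ ≤ r * |t| := by
  set F : ℝ → E := fun s => propagator G (-s) (propagator H s ψ) with hF
  have hderiv (s : ℝ) : HasDerivAt F (propagator G (-s) ((-I) • (H - G) (propagator H s ψ))) s := by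
    have h1 : HasDerivAt (fun s => propagator G (-s)) (-(propagator G (-s) * ((-I) • G))) s := by
      have := (hasDerivAt_propagator G (-s)).scomp s (hasDerivAt_neg s)
      rw [neg_one_smul] at this
      exact this
    have h2 := (h1.mul (hasDerivAt_propagator H s))
    have h3 := ((ContinuousLinearMap.apply ℂ E ψ).restrictScalars ℝ).hasFDerivAt.comp_hasDerivAt
      s h2
    have h4 : Commute ((-I) • H) (propagator H s) := (commute_propagator H s).smul_left _
    rw [← h4.eq] at h3
    convert h3 using 1
    · rfl
    change _ = (-(propagator G (-s) * ((-I) • G)) * propagator H s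
      + propagator G (-s) * ((-I) • H * propagator H s)) ψ
    simp only [add_apply, neg_apply, mul_apply_eq_comp, smul_apply, sub_apply, map_smul, map_sub,
      smul_sub]
    module
  have hbound (s : ℝ) : ‖propagator G (-s) ((-I) • (H - G) (propagator H s ψ))‖ ≤ r := by
    refine (norm_propagator_apply_le hG _ _).trans ?_
    simpa [norm_smul] using h s
  have key := Convex.norm_image_sub_le_of_norm_hasDerivWithin_le
    (fun x _ => (hderiv x).hasDerivWithinAt) (fun x _ => hbound x) (convex_univ (𝕜 := ℝ))
    (Set.mem_univ (0 : ℝ)) (Set.mem_univ t)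
  have e : (propagator H t - propagator G t) ψ = propagator G t (F t - F 0) := by
    have h5 := congrArg (fun T : E →L[ℂ] E => T (propagator H t ψ))
      (propagator_mul_propagator_neg G t)
    simp only [mul_apply_eq_comp, one_apply_eq_self] at h5
    simp [hF, h5, propagator_zero]
  rw [e]
  exact (norm_propagator_apply_le hG _ _).trans (by simpa using key)

theorem norm_propagator_sub_comp_spectralProjection_le {H G : E →L[ℂ] E} (hH : IsSelfAdjoint H)
    (hG : IsSelfAdjoint G) {r a b : ℝ} (hr : 0 ≤ r)
    (h : ∀ ψ ∈ spectralSubspace H a b, ‖(H - G) ψ‖ ≤ r * ‖ψ‖) (t : ℝ) :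
    ‖(propagator H t - propagator G t) ∘L spectralProjection H a b‖ ≤ r * |t| := by
  refine ContinuousLinearMap.opNorm_le_bound _ (by positivity) fun ψ => ?_
  rw [ContinuousLinearMap.comp_apply]
  set φ := spectralProjection H a b ψ with hφ
  have hmem : φ ∈ spectralSubspace H a b := Submodule.starProjection_apply_mem _ _
  have hnorm : ‖φ‖ ≤ ‖ψ‖ := Submodule.norm_starProjection_apply_le _ _
  refine (norm_propagator_sub_apply_le hG (r := r * ‖ψ‖) (fun s => ?_) t).trans (by
    apply le_of_eq; ring)
  refine (h _ (propagator_apply_mem_spectralSubspace s hmem)).trans ?_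
  gcongr
  exact (norm_propagator_apply_le hH _ _).trans hnorm

theorem norm_propagator_sub_comp_spectralProjection_le_two {H G : E →L[ℂ] E}
    (hH : IsSelfAdjoint H) (hG : IsSelfAdjoint G) (a b t : ℝ) :
    ‖(propagator H t - propagator G t) ∘L spectralProjection H a b‖ ≤ 2 := by
  have h1 : ‖spectralProjection H a b‖ ≤ 1 := Submodule.starProjection_norm_le _
  calc _ ≤ ‖propagator H t - propagator G t‖ * ‖spectralProjection H a b‖ :=
        ContinuousLinearMap.opNorm_comp_le _ _
    _ ≤ (1 + 1) * 1 := by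
        gcongr
        exact (norm_sub_le _ _).trans (add_le_add (norm_propagator_le_one hH t)
          (norm_propagator_le_one hG t))
    _ = 2 := by norm_num

/-! ### A bound for Sylvester equations -/

omit [CompleteSpace E] [CompleteSpace K] in
-- The numerical ranges of `H` on `S` (below `-m`) and of `-N` (above `-δ`) are separated by `m -
-- δ`. If the norm `L` of `Y` on `S` were larger than `r / (m - δ)`, testing it on `ψ + s H ψ` for
-- small `s > 0` would improve it: this vector is shorter than `ψ` to first order in `s`, while its
-- image shrinks less in proportion. No integral formula is needed.
theorem norm_apply_le_of_sylvester {S : Submodule ℂ E} {H : E →L[ℂ] E} {Y : E →L[ℂ] K}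
    {N : K →L[ℂ] K} {m M δ r : ℝ} (hS : ∀ ψ ∈ S, H ψ ∈ S)
    (hm : ∀ ψ ∈ S, (inner ℂ ψ (H ψ)).re ≤ -m * ‖ψ‖ ^ 2) (hM : ∀ ψ ∈ S, ‖H ψ‖ ≤ M * ‖ψ‖)
    (hN : ∀ χ, (inner ℂ χ (N χ)).re ≤ δ * ‖χ‖ ^ 2) (hδ : 0 ≤ δ) (hδm : δ < m) (hr : 0 ≤ r)
    (h : ∀ ψ ∈ S, ‖Y (H ψ) + N (Y ψ)‖ ≤ r * ‖ψ‖) :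
    ∀ ψ ∈ S, ‖Y ψ‖ ≤ r / (m - δ) * ‖ψ‖ := by
  set L := ‖Y ∘L S.subtypeL‖ with hL
  have hL0 : 0 ≤ L := ContinuousLinearMap.opNorm_nonneg _
  have hLY (ψ : E) (hψ : ψ ∈ S) : ‖Y ψ‖ ≤ L * ‖ψ‖ :=
    (Y ∘L S.subtypeL).le_opNorm ⟨ψ, hψ⟩
  suffices hLr : (m - δ) * L ≤ r by
    intro ψ hψ
    refine (hLY ψ hψ).trans ?_
    gcongr
    rwa [le_div_iff₀ (by linarith), mul_comm]
  by_contra! hlt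
  obtain ⟨g, hg⟩ : ∃ g, g = (m - δ) * L - r := ⟨_, rfl⟩
  have hg0 : 0 < g := by linarith
  have hLpos : 0 < L := by
    rcases hL0.eq_or_lt with h0 | h0
    · rw [← h0] at hlt; linarith
    · exact h0
  -- Small enough that the second-order term `s² L² M²` absorbs at most half of the first-order gain
  -- `2 s L g`; the `+ 1` covers `M = 0`.
  set s := g / (L * M ^ 2 + 1) with hs
  have hs0 : 0 < s := by positivity
  have hsM : L * s * M ^ 2 ≤ g := by
    rw [hs, mul_div_assoc', div_mul_eq_mul_div, div_le_iff₀ (by positivity)]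
    nlinarith
  have hb (ψ : E) (hψ : ψ ∈ S) : ‖Y ψ‖ ^ 2 ≤ (L ^ 2 - s * L * g) * ‖ψ‖ ^ 2 := by
    have h1 := hLY (ψ + (s : ℂ) • H ψ) (S.add_mem hψ (S.smul_mem _ (hS ψ hψ)))
    have h2 : ‖Y (ψ + (s : ℂ) • H ψ)‖ ^ 2 ≤ L ^ 2 * ‖ψ + (s : ℂ) • H ψ‖ ^ 2 := by
      rw [← mul_pow]; gcongr
    rw [map_add, map_smul, norm_add_sq (𝕜 := ℂ), norm_add_sq (𝕜 := ℂ), inner_smul_right,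
      inner_smul_right, norm_smul, norm_smul, Complex.norm_of_nonneg hs0.le] at h2
    simp only [RCLike.re_to_complex, Complex.re_ofReal_mul] at h2
    have h3 : -(r * L * ‖ψ‖ ^ 2) - δ * L ^ 2 * ‖ψ‖ ^ 2 ≤ (inner ℂ (Y ψ) (Y (H ψ))).re := by
      have h4 : -(r * L * ‖ψ‖ ^ 2) ≤ (inner ℂ (Y ψ) (Y (H ψ) + N (Y ψ))).re := by
        have h5 := (abs_le.1 ((Complex.abs_re_le_norm _).trans
          (norm_inner_le_norm (𝕜 := ℂ) (Y ψ) (Y (H ψ) + N (Y ψ))))).1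
        have h6 : ‖Y ψ‖ * ‖Y (H ψ) + N (Y ψ)‖ ≤ (L * ‖ψ‖) * (r * ‖ψ‖) := by
          gcongr
          · exact hLY ψ hψ
          · exact h ψ hψ
        nlinarith
      rw [inner_add_right, Complex.add_re] at h4
      have h7 := hN (Y ψ)
      have h8 : ‖Y ψ‖ ^ 2 ≤ L ^ 2 * ‖ψ‖ ^ 2 := by
        rw [← mul_pow]; gcongr; exact hLY ψ hψ
      nlinarith
    have h9 := hm ψ hψ
    have h10 : ‖H ψ‖ ^ 2 ≤ M ^ 2 * ‖ψ‖ ^ 2 := by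
      rw [← mul_pow]; gcongr; exact hM ψ hψ
    have h11 : 2 * s * (-(r * L * ‖ψ‖ ^ 2) - δ * L ^ 2 * ‖ψ‖ ^ 2)
        ≤ 2 * s * (inner ℂ (Y ψ) (Y (H ψ))).re := by gcongr
    have h12 : 2 * s * L ^ 2 * (inner ℂ ψ (H ψ)).re ≤ 2 * s * L ^ 2 * (-m * ‖ψ‖ ^ 2) := by gcongr
    have h13 : L ^ 2 * s ^ 2 * ‖H ψ‖ ^ 2 ≤ L ^ 2 * s ^ 2 * (M ^ 2 * ‖ψ‖ ^ 2) := by gcongr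
    have h14 : (L * s * M ^ 2) * (L * s * ‖ψ‖ ^ 2) ≤ g * (L * s * ‖ψ‖ ^ 2) := by gcongr
    have h15 : 0 ≤ (s * ‖Y (H ψ)‖) ^ 2 := by positivity
    subst hg
    nlinarith
  -- If this were negative, `Y` would vanish on `S`, against `0 < L`. Otherwise its square root is a
  -- bound for the norm smaller than `L`.
  have hq : 0 ≤ L ^ 2 - s * L * g := by
    by_contra! hneg
    have : L ≤ 0 := by
      refine ContinuousLinearMap.opNorm_le_bound _ le_rfl fun ψ => ?_
      have := hb ψ ψ.2
      have h2 : ‖Y ψ‖ ^ 2 ≤ 0 := this.trans (mul_nonpos_of_nonpos_of_nonneg hneg.le (sq_nonneg _))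
      have h3 : ‖Y ψ‖ = 0 := by nlinarith [norm_nonneg (Y ψ)]
      simp [h3]
    linarith
  have hfin : L ≤ Real.sqrt (L ^ 2 - s * L * g) := by
    refine ContinuousLinearMap.opNorm_le_bound _ (Real.sqrt_nonneg _) fun ψ => ?_
    refine le_of_sq_le_sq ?_ (by positivity)
    rw [mul_pow, Real.sq_sqrt hq]
    exact hb ψ ψ.2
  have hfin2 := (Real.le_sqrt hL0 hq).1 hfin
  have : 0 < s * L * g := by positivity
  linarith

end Abstract

/-! ### Approximate evolution equations for the components of states of negative energy. -/

section AbstractModel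

open Complex ContinuousLinearMap

variable {E K F : Type*} [NormedAddCommGroup E] [InnerProductSpace ℂ E]
  [NormedAddCommGroup K] [InnerProductSpace ℂ K] [NormedAddCommGroup F] [InnerProductSpace ℂ F]

/-! ### Bookkeeping of linear bounds -/

/-- These rules keep every bound in the form `k * q`, with `q` equal to `‖ψ‖` or a small factor
times it. The constant is then assembled by unification from the shape of the expression, which
explains the unsimplified form of the constants below. -/
theorem norm_map_le_mul {T : K →L[ℂ] F} {w k q : ℝ} {χ : K} (hT : ‖T‖ ≤ w) (h : ‖χ‖ ≤ k * q) :
    ‖T χ‖ ≤ (w * k) * q := by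
  rw [mul_assoc]
  exact T.le_of_opNorm_le_of_le hT h

theorem norm_map_le_mul_of_norm_le_one {T : K →L[ℂ] F} {k q : ℝ} {χ : K} (hT : ‖T‖ ≤ 1)
    (h : ‖χ‖ ≤ k * q) : ‖T χ‖ ≤ k * q := by
  simpa using norm_map_le_mul hT h

omit [InnerProductSpace ℂ K] in
theorem norm_add_le_mul {a b : K} {k l q : ℝ} (ha : ‖a‖ ≤ k * q) (hb : ‖b‖ ≤ l * q) :
    ‖a + b‖ ≤ (k + l) * q := by
  rw [add_mul]; exact norm_add_le_of_le ha hb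

omit [InnerProductSpace ℂ K] in
theorem norm_sub_le_mul {a b : K} {k l q : ℝ} (ha : ‖a‖ ≤ k * q) (hb : ‖b‖ ≤ l * q) :
    ‖a - b‖ ≤ (k + l) * q := by
  rw [add_mul]; exact norm_sub_le_of_le ha hb

theorem norm_real_smul_le_mul {s c : ℝ} {χ : K} {k q : ℝ} (hs : |s| ≤ c) (h : ‖χ‖ ≤ k * q) :
    ‖(s : ℂ) • χ‖ ≤ (c * k) * q := by
  rw [norm_smul, Complex.norm_real, Real.norm_eq_abs, mul_assoc]
  gcongr
  exact (abs_nonneg _).trans hs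

theorem norm_small_smul_le_mul {s η : ℝ} {χ : K} {k q : ℝ} (hs : |s| ≤ η) (h : ‖χ‖ ≤ k * q) :
    ‖(s : ℂ) • χ‖ ≤ k * (η * q) := by
  refine (norm_real_smul_le_mul hs h).trans (le_of_eq ?_)
  ring

/-- The estimate on the difference of the coupled and the effective models on a subspace of
negative energy of the coupled one. -/
theorem norm_model_sub_apply_le {P D B : E →L[ℂ] K} {V A : K →L[ℂ] K} {H T : E →L[ℂ] E}
    {S : Submodule ℂ E} {γ hop U m M w τ η c₁ c₂ c₃ c₄ c₅ c₆ c₇ : ℝ}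
    (hS : ∀ ψ ∈ S, H ψ ∈ S)
    (hm : ∀ ψ ∈ S, (inner ℂ ψ (H ψ)).re ≤ -m * ‖ψ‖ ^ 2) (hM : ∀ ψ ∈ S, ‖H ψ‖ ≤ M * ‖ψ‖)
    (hP : ‖P‖ ≤ 1) (hD : ‖D‖ ≤ 1) (hB : ‖B‖ ≤ 1) (hV : ‖V‖ ≤ w) (hA : ‖A‖ ≤ w) (hT : ‖T‖ ≤ τ)
    (hγ : 0 < γ) (hm0 : 0 < m) (hM0 : 0 ≤ M)
    (hhop : 0 < hop) (hhop1 : hop ≤ 1) (hU1 : 1 ≤ U) (hUw : w ^ 2 / U ≤ m)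
    (hη : η = hop + (U ^ 2)⁻¹)
    (hVA : ∀ χ, V (A χ) = A (V χ)) (hAA : ∀ χ, A (A χ) = V (V χ))
    (hA0 : ∀ χ, 0 ≤ (inner ℂ χ (A χ)).re)
    (hPH : ∀ ψ, P (H ψ) = (U : ℂ) • P ψ + V (B ψ) + (hop : ℂ) • P (T ψ))
    (hDH : ∀ ψ, D (H ψ) = (γ : ℂ) • V (B ψ) + (hop : ℂ) • D (T ψ))
    (hBH : ∀ ψ, B (H ψ) = V (P ψ) + (γ : ℂ) • V (D ψ) + (hop : ℂ) • B (T ψ))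
    (hc₁ : c₁ = M + w + τ) (hc₂ : c₂ = c₁ * M + τ)
    (hc₃ : c₃ = w * (c₂ * M) + (γ * (w * τ) + τ * M)) (hc₄ : c₄ = c₃ + w * (w * (w * w)))
    (hc₅ : c₅ = c₄ / (m / 2))
    (hc₆ : c₆ = γ * (w * c₅) + (τ * M + γ * (w * τ) + w * (w * τ))) (hc₇ : c₇ = c₆ / m) :
    ∀ ψ ∈ S,
      ‖((γ : ℂ) • A (B ψ) + ((1 / (2 * U) : ℝ) : ℂ) • V (V (B ψ))) + V (P ψ + (γ : ℂ) • D ψ)‖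
        ≤ (c₅ + τ) * (η * ‖ψ‖) ∧
      ‖((γ⁻¹ : ℝ) : ℂ) • A (P ψ + (γ : ℂ) • D ψ)
          - ((γ⁻¹ ^ 2 / (2 * U + 1) : ℝ) : ℂ) • V (V (P ψ + (γ : ℂ) • D ψ)) + V (B ψ)‖
        ≤ γ⁻¹ * (w * c₂ + c₇ + τ + γ⁻¹ * (w * c₇) + γ⁻¹ * (w * τ) + γ⁻¹ * (w * (w * w)) + w * w
            + γ⁻¹ * (w * (w * c₁))) * (η * ‖ψ‖) := by
  have hw : 0 ≤ w := (norm_nonneg _).trans hV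
  have hτ : 0 ≤ τ := (norm_nonneg _).trans hT
  have hU0 : 0 < U := by linarith
  have hc₁0 : 0 ≤ c₁ := by rw [hc₁]; positivity
  have hc₂0 : 0 ≤ c₂ := by rw [hc₂]; positivity
  have hc₃0 : 0 ≤ c₃ := by rw [hc₃]; positivity
  have hc₄0 : 0 ≤ c₄ := by rw [hc₄]; positivity
  have hc₅0 : 0 ≤ c₅ := by rw [hc₅]; positivity
  have hc₆0 : 0 ≤ c₆ := by rw [hc₆]; positivity
  have hUinv : U⁻¹ ≤ 1 := inv_le_one_of_one_le₀ hU1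
  have hhopη : |hop| ≤ η := by rw [abs_of_pos hhop, hη]; linarith [inv_pos.2 (pow_pos hU0 2)]
  have hUη : |(U ^ 2)⁻¹| ≤ η := by rw [abs_of_pos (by positivity), hη]; linarith
  have hη0 : 0 ≤ η := (abs_nonneg _).trans hhopη
  have hγ' : |γ| ≤ γ := (abs_of_pos hγ).le
  have hγi : |γ⁻¹| ≤ γ⁻¹ := (abs_of_pos (inv_pos.2 hγ)).le
  have hU' : |U⁻¹| ≤ 1 := by rw [abs_of_pos (inv_pos.2 hU0)]; exact hUinv
  have hU2' : |1 / (2 * U)| ≤ 1 := by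
    rw [abs_of_pos (by positivity), div_le_one (by positivity)]; linarith
  have hγC : (γ : ℂ) ≠ 0 := by exact_mod_cast hγ.ne'
  have hUC : (U : ℂ) ≠ 0 := by exact_mod_cast hU0.ne'
  have hUC1 : (2 * U + 1 : ℂ) ≠ 0 := by exact_mod_cast (by positivity : (2 * U + 1 : ℝ) ≠ 0)
  have triv (ψ : E) : ‖ψ‖ ≤ 1 * ‖ψ‖ := by simp
  have bT (ψ : E) : ‖T ψ‖ ≤ τ * ‖ψ‖ := by simpa using norm_map_le_mul hT (triv ψ)
  have bP (ψ : E) : ‖P ψ‖ ≤ 1 * ‖ψ‖ := norm_map_le_mul_of_norm_le_one hP (triv ψ)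
  have bD (ψ : E) : ‖D ψ‖ ≤ 1 * ‖ψ‖ := norm_map_le_mul_of_norm_le_one hD (triv ψ)
  have bB (ψ : E) : ‖B ψ‖ ≤ 1 * ‖ψ‖ := norm_map_le_mul_of_norm_le_one hB (triv ψ)
  have bTH (ψ : E) (hψ : ψ ∈ S) : ‖T (H ψ)‖ ≤ (τ * M) * ‖ψ‖ := norm_map_le_mul hT (hM ψ hψ)
  -- the doubly occupied component is of order `1 / U`
  have hP1 (ψ : E) (hψ : ψ ∈ S) : ‖P ψ‖ ≤ c₁ * (U⁻¹ * ‖ψ‖) := by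
    have h1 : P ψ = ((U⁻¹ : ℝ) : ℂ) • (P (H ψ) - V (B ψ) - (hop : ℂ) • P (T ψ)) := by
      rw [hPH]; push_cast; match_scalars <;> field_simp <;> ring
    rw [h1]
    refine norm_small_smul_le_mul (abs_of_pos (inv_pos.2 hU0)).le ?_
    refine (norm_sub_le_mul (norm_sub_le_mul
      (norm_map_le_mul_of_norm_le_one hP (hM ψ hψ)) (norm_map_le_mul hV (bB ψ)))
      (norm_real_smul_le_mul (c := 1) (by rwa [abs_of_pos hhop])
        (norm_map_le_mul_of_norm_le_one hP (bT ψ)))).trans (le_of_eq ?_)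
    rw [hc₁]; ring
  have hP2 (ψ : E) (hψ : ψ ∈ S) :
      ‖P ψ + ((U⁻¹ : ℝ) : ℂ) • V (B ψ)‖ ≤ c₂ * (η * ‖ψ‖) := by
    have h1 : P ψ + ((U⁻¹ : ℝ) : ℂ) • V (B ψ) =
        ((U⁻¹ : ℝ) : ℂ) • P (H ψ) - (hop : ℂ) • (((U⁻¹ : ℝ) : ℂ) • P (T ψ)) := by
      rw [hPH]; push_cast; match_scalars <;> field_simp <;> ring
    rw [h1, hc₂]
    refine norm_sub_le_mul ?_ (norm_small_smul_le_mul hhopη ?_)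
    -- `H ψ` lies in `S` again, so the bound of order `1 / U` applies to it; the prefactor `U⁻¹`
    -- makes the term of order `U⁻²`.
    · have h2 : ‖P (H ψ)‖ ≤ (c₁ * M) * (U⁻¹ * ‖ψ‖) := by
        refine (hP1 _ (hS ψ hψ)).trans ?_
        calc c₁ * (U⁻¹ * ‖H ψ‖) ≤ c₁ * (U⁻¹ * (M * ‖ψ‖)) := by gcongr; exact hM ψ hψ
          _ = _ := by ring
      refine (norm_real_smul_le_mul (abs_of_pos (inv_pos.2 hU0)).le h2).trans ?_
      calc U⁻¹ * (c₁ * M) * (U⁻¹ * ‖ψ‖) = (c₁ * M) * ((U ^ 2)⁻¹ * ‖ψ‖) := by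
            rw [sq, mul_inv]; ring
        _ ≤ (c₁ * M) * (η * ‖ψ‖) := by gcongr; exact (le_abs_self _).trans hUη
    · simpa using norm_real_smul_le_mul hU' (norm_map_le_mul_of_norm_le_one hP (bT ψ))
  -- Eliminating the pair amplitudes from `B H²` gives the quadratic operator equation for the boson
  -- component.
  have hq (ψ : E) (hψ : ψ ∈ S) :
      ‖B (H (H ψ)) + ((U⁻¹ : ℝ) : ℂ) • V (V (B (H ψ))) - ((γ : ℂ) ^ 2) • V (V (B ψ))‖
        ≤ c₃ * (η * ‖ψ‖) := by
    have h1 : B (H (H ψ)) + ((U⁻¹ : ℝ) : ℂ) • V (V (B (H ψ))) - ((γ : ℂ) ^ 2) • V (V (B ψ)) =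
        V (P (H ψ) + ((U⁻¹ : ℝ) : ℂ) • V (B (H ψ))) +
          (hop : ℂ) • ((γ : ℂ) • V (D (T ψ)) + B (T (H ψ))) := by
      rw [hBH (H ψ), hDH ψ]
      simp only [map_add, map_smul]
      module
    rw [h1, hc₃]
    refine norm_add_le_mul (norm_map_le_mul hV ?_) (norm_small_smul_le_mul hhopη
      (norm_add_le_mul (norm_real_smul_le_mul hγ' (norm_map_le_mul hV
        (norm_map_le_mul_of_norm_le_one hD (bT ψ))))
        (norm_map_le_mul_of_norm_le_one hB (bTH ψ hψ))))
    refine (hP2 _ (hS ψ hψ)).trans ?_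
    calc c₂ * (η * ‖H ψ‖) ≤ c₂ * (η * (M * ‖ψ‖)) := by gcongr; exact hM ψ hψ
      _ = _ := by ring
  -- the bosonic component approximately evolves by the effective hopping
  set Z : E →L[ℂ] K := B ∘L H + ((1 / (2 * U) : ℝ) : ℂ) • (V ∘L V ∘L B) + (γ : ℂ) • (A ∘L B)
    with hZdef
  -- The quadratic is factorized by completing the square: since `A² = V²`, the product of `V²/(2U)
  -- - γA` and `V²/(2U) + γA` is `-γ²V² + V⁴/(4U²)`, and the last term is negligible.
  set N : K →L[ℂ] K := ((1 / (2 * U) : ℝ) : ℂ) • (V ∘L V) - (γ : ℂ) • A with hNdef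
  have hZ : ∀ ψ ∈ S, ‖Z ψ‖ ≤ c₅ * (η * ‖ψ‖) := by
    -- Positivity of `A` discards `-γA`, and `U ≥ w² / m` controls the rest, leaving a gap `m / 2`
    -- for the Sylvester bound.
    have hN (χ : K) : (inner ℂ χ (N χ)).re ≤ m / 2 * ‖χ‖ ^ 2 := by
      have e : (inner ℂ χ (N χ)).re =
          1 / (2 * U) * (inner ℂ χ (V (V χ))).re - γ * (inner ℂ χ (A χ)).re := by
        simp only [hNdef, sub_apply, smul_apply, comp_apply, inner_sub_right, inner_smul_right,
          Complex.sub_re, Complex.re_ofReal_mul]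
      have h1 : (inner ℂ χ (V (V χ))).re ≤ w ^ 2 * ‖χ‖ ^ 2 := by
        have h2 : ‖V (V χ)‖ ≤ (w * (w * 1)) * ‖χ‖ :=
          norm_map_le_mul hV (norm_map_le_mul hV (by simp))
        calc _ ≤ ‖inner ℂ χ (V (V χ))‖ := Complex.re_le_norm _
          _ ≤ ‖χ‖ * ‖V (V χ)‖ := norm_inner_le_norm _ _
          _ ≤ ‖χ‖ * ((w * (w * 1)) * ‖χ‖) := by gcongr
          _ = _ := by ring
      rw [e]
      have h3 := mul_nonneg hγ.le (hA0 χ)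
      have h4 : 1 / (2 * U) * (inner ℂ χ (V (V χ))).re ≤ 1 / (2 * U) * (w ^ 2 * ‖χ‖ ^ 2) := by
        gcongr
      have h5 : 1 / (2 * U) * (w ^ 2 * ‖χ‖ ^ 2) = (w ^ 2 / U) / 2 * ‖χ‖ ^ 2 := by
        field_simp
      have h6 : (w ^ 2 / U) / 2 * ‖χ‖ ^ 2 ≤ m / 2 * ‖χ‖ ^ 2 := by gcongr
      linarith
    have key := norm_apply_le_of_sylvester (Y := Z) (r := c₄ * η) hS hm hM hN (by positivity)
      (by linarith) (by positivity) (fun ψ hψ => ?_)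
    · intro ψ hψ
      refine (key ψ hψ).trans (le_of_eq ?_)
      rw [hc₅]; ring
    · have h1 : Z (H ψ) + N (Z ψ) = (B (H (H ψ)) + ((U⁻¹ : ℝ) : ℂ) • V (V (B (H ψ)))
          - ((γ : ℂ) ^ 2) • V (V (B ψ)))
          + (((U ^ 2)⁻¹ : ℝ) : ℂ) • (((1 / 4 : ℝ) : ℂ) • V (V (V (V (B ψ))))) := by
        simp only [hZdef, hNdef, add_apply, sub_apply, smul_apply, comp_apply, map_add, map_smul,
          hAA, ← hVA]
        push_cast
        match_scalars <;> field_simp <;> ring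
      rw [h1, mul_assoc, hc₄]
      refine norm_add_le_mul (hq ψ hψ) (norm_small_smul_le_mul hUη ?_)
      have h2 := norm_real_smul_le_mul (s := 1 / 4) (c := 1) (by norm_num [abs_le])
        (norm_map_le_mul hV (norm_map_le_mul hV (norm_map_le_mul hV (norm_map_le_mul hV (bB ψ)))))
      simpa using h2
  -- so does the singly occupied component
  set R : E →L[ℂ] K := D ∘L H + (γ : ℂ) • (A ∘L D) + ((1 / (2 * U) : ℝ) : ℂ) • (V ∘L V ∘L D)
    with hRdef
  have hR : ∀ ψ ∈ S, ‖R ψ‖ ≤ c₇ * (η * ‖ψ‖) := by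
    -- Here `R H` is itself small, being `γ V Z` up to hopping terms, so inverting `H` on `S`
    -- suffices and `N = 0`.
    have key := norm_apply_le_of_sylvester (Y := R) (N := 0) (δ := 0) (r := c₆ * η) hS hm hM
      (by simp) le_rfl hm0 (by positivity) (fun ψ hψ => ?_)
    · intro ψ hψ
      refine (key ψ hψ).trans (le_of_eq ?_)
      rw [hc₇]; ring
    · have h1 : R (H ψ) + (0 : K →L[ℂ] K) (R ψ) = (γ : ℂ) • V (Z ψ)
          + (hop : ℂ) • (D (T (H ψ)) + (γ : ℂ) • A (D (T ψ))
            + ((1 / (2 * U) : ℝ) : ℂ) • V (V (D (T ψ)))) := by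
        simp only [hZdef, hRdef, add_apply, smul_apply, comp_apply, zero_apply, add_zero]
        rw [hDH (H ψ), hDH ψ]
        simp only [map_add, map_smul, hVA]
        module
      rw [h1, mul_assoc, hc₆]
      refine norm_add_le_mul (norm_real_smul_le_mul hγ' (norm_map_le_mul hV (hZ ψ hψ)))
        (norm_small_smul_le_mul hhopη (norm_add_le_mul (norm_add_le_mul
        (norm_map_le_mul_of_norm_le_one hD (bTH ψ hψ))
        (norm_real_smul_le_mul hγ' (norm_map_le_mul hA
          (norm_map_le_mul_of_norm_le_one hD (bT ψ))))) ?_))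
      simpa using norm_real_smul_le_mul hU2' (norm_map_le_mul hV (norm_map_le_mul hV
        (norm_map_le_mul_of_norm_le_one hD (bT ψ))))
  intro ψ hψ
  constructor
  · have h1 : ((γ : ℂ) • A (B ψ) + ((1 / (2 * U) : ℝ) : ℂ) • V (V (B ψ))) +
        V (P ψ + (γ : ℂ) • D ψ) = Z ψ - (hop : ℂ) • B (T ψ) := by
      simp only [hZdef, add_apply, smul_apply, comp_apply, hBH ψ, map_add, map_smul]
      module
    rw [h1]
    exact norm_sub_le_mul (hZ ψ hψ) (norm_small_smul_le_mul hhopη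
      (norm_map_le_mul_of_norm_le_one hB (bT ψ)))
  -- The terms of order `1 / U` cancel: replacing `P` by `-U⁻¹ V B`, and then `V B` by `-A D` up to
  -- errors, turns `A P` into `U⁻¹ V² D`. Then `1/U - 1/(2U) - 1/(2U + 1) = 1/(2U(2U + 1))` is of
  -- order `U⁻²`, so using `2U + 1` in place of `2U` costs nothing at this order.
  · have h1 : ((γ⁻¹ : ℝ) : ℂ) • A (P ψ + (γ : ℂ) • D ψ)
          - ((γ⁻¹ ^ 2 / (2 * U + 1) : ℝ) : ℂ) • V (V (P ψ + (γ : ℂ) • D ψ)) + V (B ψ) =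
        ((γ⁻¹ : ℝ) : ℂ) • (A (P ψ + ((U⁻¹ : ℝ) : ℂ) • V (B ψ)) + R ψ - (hop : ℂ) • D (T ψ)
          - ((U⁻¹ : ℝ) : ℂ) • (((γ⁻¹ : ℝ) : ℂ) • A (R ψ))
          + (hop : ℂ) • (((U⁻¹ : ℝ) : ℂ) • (((γ⁻¹ : ℝ) : ℂ) • A (D (T ψ))))
          + (((U ^ 2)⁻¹ : ℝ) : ℂ) • (((1 / 2 : ℝ) : ℂ) • (((γ⁻¹ : ℝ) : ℂ) • A (V (V (D ψ)))))
          + ((1 / (2 * U * (2 * U + 1)) : ℝ) : ℂ) • V (V (D ψ))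
          - ((1 / (2 * U + 1) : ℝ) : ℂ) • (((γ⁻¹ : ℝ) : ℂ) • V (V (P ψ)))) := by
      simp only [hRdef, add_apply, smul_apply, comp_apply, hDH ψ, map_add, map_smul, hAA]
      push_cast
      match_scalars <;> field_simp <;> ring
    rw [h1]
    have hη1 : |1 / (2 * U * (2 * U + 1))| ≤ η := by
      refine le_trans ?_ hUη
      rw [abs_of_pos (by positivity), abs_of_pos (by positivity), one_div]
      gcongr
      nlinarith
    refine norm_real_smul_le_mul hγi (norm_sub_le_mul (norm_add_le_mul (norm_add_le_mul
      (norm_add_le_mul (norm_sub_le_mul (norm_sub_le_mul (norm_add_le_mul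
      (norm_map_le_mul hA (hP2 ψ hψ)) (hR ψ hψ)) ?_) ?_) ?_) ?_) ?_) ?_)
    · exact norm_small_smul_le_mul hhopη (norm_map_le_mul_of_norm_le_one hD (bT ψ))
    · simpa using norm_real_smul_le_mul hU' (norm_real_smul_le_mul hγi
        (norm_map_le_mul hA (hR ψ hψ)))
    · refine norm_small_smul_le_mul hhopη ?_
      simpa using norm_real_smul_le_mul hU' (norm_real_smul_le_mul hγi
        (norm_map_le_mul hA (norm_map_le_mul_of_norm_le_one hD (bT ψ))))
    · refine norm_small_smul_le_mul hUη ?_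
      simpa using norm_real_smul_le_mul (s := 1 / 2) (c := 1) (by norm_num [abs_le])
        (norm_real_smul_le_mul hγi (norm_map_le_mul hA (norm_map_le_mul hV
          (norm_map_le_mul hV (bD ψ)))))
    · refine norm_small_smul_le_mul hη1 ?_
      simpa using norm_map_le_mul hV (norm_map_le_mul hV (bD ψ))
    · have h2 := norm_real_smul_le_mul (s := 1 / (2 * U + 1)) (c := U⁻¹) (by
        rw [abs_of_pos (by positivity), one_div]
        gcongr
        linarith) (norm_real_smul_le_mul hγi (norm_map_le_mul hV (norm_map_le_mul hV (hP1 ψ hψ))))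
      refine h2.trans ?_
      calc U⁻¹ * (γ⁻¹ * (w * (w * c₁))) * (U⁻¹ * ‖ψ‖)
          = (γ⁻¹ * (w * (w * c₁))) * ((U ^ 2)⁻¹ * ‖ψ‖) := by rw [sq, mul_inv]; ring
        _ ≤ (γ⁻¹ * (w * (w * c₁))) * (η * ‖ψ‖) := by
          gcongr
          exact (le_abs_self _).trans hUη

end AbstractModel

/-! ### The abstract theorem for three orthogonal channels. -/

section AbstractTheorem

open Complex ContinuousLinearMap

variable {E K : Type*} [NormedAddCommGroup E] [InnerProductSpace ℂ E] [CompleteSpace E]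
  [NormedAddCommGroup K] [InnerProductSpace ℂ K] [CompleteSpace K]

/-- Adjoints of isometries with mutually orthogonal ranges. -/
structure IsChannelTriple (P D B : E →L[ℂ] K) : Prop where
  PP : P ∘L adjoint P = 1
  DD : D ∘L adjoint D = 1
  BB : B ∘L adjoint B = 1
  PD : P ∘L adjoint D = 0
  PB : P ∘L adjoint B = 0
  DB : D ∘L adjoint B = 0

/-- The pair annihilation operator in terms of its two channels. -/
noncomputable def pairChannel (P D : E →L[ℂ] K) (γ : ℝ) : E →L[ℂ] K := P + (γ : ℂ) • D

/-- The boson-fermion Hamiltonian in the presence of one pair. -/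
noncomputable def coupledModel (P D B : E →L[ℂ] K) (V : K →L[ℂ] K) (T : E →L[ℂ] E)
    (γ hop U : ℝ) : E →L[ℂ] E :=
  (U : ℂ) • (adjoint P ∘L P) +
    (adjoint (pairChannel P D γ) ∘L V ∘L B + adjoint B ∘L V ∘L pairChannel P D γ) + (hop : ℂ) • T

/-- The uncoupled Hamiltonian in the presence of one pair. -/
noncomputable def uncoupledModel (P D B : E →L[ℂ] K) (Wf Wb : K →L[ℂ] K) (T : E →L[ℂ] E)
    (γ hop U : ℝ) : E →L[ℂ] E :=
  (U : ℂ) • (adjoint P ∘L P) - adjoint (pairChannel P D γ) ∘L Wf ∘L pairChannel P D γ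
    - adjoint B ∘L Wb ∘L B + (hop : ℂ) • T

theorem isSelfAdjoint_real_smul {T : E →L[ℂ] E} (s : ℝ) (hT : IsSelfAdjoint T) :
    IsSelfAdjoint ((s : ℂ) • T) := by
  rw [Complex.coe_smul]
  exact IsSelfAdjoint.smul (.all s) hT

theorem isSelfAdjoint_coupledModel {P D B : E →L[ℂ] K} {V : K →L[ℂ] K} {T : E →L[ℂ] E}
    {γ hop U : ℝ} (hV : IsSelfAdjoint V) (hT : IsSelfAdjoint T) :
    IsSelfAdjoint (coupledModel P D B V T γ hop U) := by
  have h1 : IsSelfAdjoint (adjoint P ∘L P) := by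
    rw [isSelfAdjoint_iff']; simp [adjoint_comp]
  refine ((isSelfAdjoint_real_smul U h1).add ?_).add (isSelfAdjoint_real_smul hop hT)
  rw [isSelfAdjoint_iff'] at hV ⊢
  simp only [map_add, adjoint_comp, adjoint_adjoint, hV]
  rw [add_comm]
  rfl

theorem isSelfAdjoint_adjoint_comp_comp {P : E →L[ℂ] K} {W : K →L[ℂ] K} (hW : IsSelfAdjoint W) :
    IsSelfAdjoint (adjoint P ∘L W ∘L P) := by
  rw [isSelfAdjoint_iff'] at hW ⊢
  simp only [adjoint_comp, adjoint_adjoint, hW]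
  rfl

theorem isSelfAdjoint_uncoupledModel {P D B : E →L[ℂ] K} {Wf Wb : K →L[ℂ] K} {T : E →L[ℂ] E}
    {γ hop U : ℝ} (hWf : IsSelfAdjoint Wf) (hWb : IsSelfAdjoint Wb) (hT : IsSelfAdjoint T) :
    IsSelfAdjoint (uncoupledModel P D B Wf Wb T γ hop U) := by
  have h1 : IsSelfAdjoint (adjoint P ∘L P) := by
    rw [isSelfAdjoint_iff']; simp [adjoint_comp]
  exact (((isSelfAdjoint_real_smul U h1).sub (isSelfAdjoint_adjoint_comp_comp hWf)).sub
    (isSelfAdjoint_adjoint_comp_comp hWb)).add (isSelfAdjoint_real_smul hop hT)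

theorem norm_le_one_of_comp_adjoint {P : E →L[ℂ] K} (h : P ∘L adjoint P = 1) : ‖P‖ ≤ 1 := by
  have h1 : ‖P ∘L adjoint P‖ = ‖P‖ * ‖P‖ := by
    have := norm_adjoint_comp_self (adjoint P)
    rwa [adjoint_adjoint, LinearIsometryEquiv.norm_map] at this
  have h2 : ‖P‖ * ‖P‖ ≤ 1 := by
    rw [← h1, h]
    exact norm_id_le
  nlinarith [norm_nonneg P]

theorem comp_adjoint_swap {P D : E →L[ℂ] K} (h : P ∘L adjoint D = 0) : D ∘L adjoint P = 0 := by
  have := congrArg adjoint h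
  simpa [adjoint_comp] using this

omit [CompleteSpace E] [CompleteSpace K] in
theorem pairChannel_apply (P D : E →L[ℂ] K) (γ : ℝ) (ψ : E) :
    pairChannel P D γ ψ = P ψ + (γ : ℂ) • D ψ := rfl

theorem adjoint_pairChannel_apply (P D : E →L[ℂ] K) (γ : ℝ) (χ : K) :
    adjoint (pairChannel P D γ) χ = adjoint P χ + (γ : ℂ) • adjoint D χ := by
  rw [pairChannel, map_add, map_smulₛₗ, Complex.conj_ofReal]
  rfl

namespace IsChannelTriple

variable {P D B : E →L[ℂ] K} {V : K →L[ℂ] K} {T : E →L[ℂ] E} {γ hop U : ℝ}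

theorem P_coupledModel (h : IsChannelTriple P D B) (ψ : E) :
    P (coupledModel P D B V T γ hop U ψ) = (U : ℂ) • P ψ + V (B ψ) + (hop : ℂ) • P (T ψ) := by
  have e1 (χ : K) : P (adjoint P χ) = χ := DFunLike.congr_fun h.PP χ
  have e2 (χ : K) : P (adjoint D χ) = 0 := DFunLike.congr_fun h.PD χ
  have e3 (χ : K) : P (adjoint B χ) = 0 := DFunLike.congr_fun h.PB χ
  simp only [coupledModel, add_apply, smul_apply, comp_apply, adjoint_pairChannel_apply, map_add,
    map_smul, e1, e2, e3, smul_zero, add_zero, zero_add, pairChannel_apply]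

theorem D_coupledModel (h : IsChannelTriple P D B) (ψ : E) :
    D (coupledModel P D B V T γ hop U ψ) = (γ : ℂ) • V (B ψ) + (hop : ℂ) • D (T ψ) := by
  have e1 (χ : K) : D (adjoint P χ) = 0 := DFunLike.congr_fun (comp_adjoint_swap h.PD) χ
  have e2 (χ : K) : D (adjoint D χ) = χ := DFunLike.congr_fun h.DD χ
  have e3 (χ : K) : D (adjoint B χ) = 0 := DFunLike.congr_fun h.DB χ
  simp only [coupledModel, add_apply, smul_apply, comp_apply, adjoint_pairChannel_apply, map_add,
    map_smul, e1, e2, e3, smul_zero, add_zero, zero_add, pairChannel_apply]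

theorem B_coupledModel (h : IsChannelTriple P D B) (ψ : E) :
    B (coupledModel P D B V T γ hop U ψ) =
      V (P ψ) + (γ : ℂ) • V (D ψ) + (hop : ℂ) • B (T ψ) := by
  have e1 (χ : K) : B (adjoint P χ) = 0 := DFunLike.congr_fun (comp_adjoint_swap h.PB) χ
  have e2 (χ : K) : B (adjoint D χ) = 0 := DFunLike.congr_fun (comp_adjoint_swap h.DB) χ
  have e3 (χ : K) : B (adjoint B χ) = χ := DFunLike.congr_fun h.BB χ
  simp only [coupledModel, add_apply, smul_apply, comp_apply, adjoint_pairChannel_apply, map_add,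
    map_smul, e1, e2, e3, smul_zero, add_zero, zero_add, pairChannel_apply]

theorem norm_pairChannel_le (h : IsChannelTriple P D B) (hγ : 0 < γ) :
    ‖pairChannel P D γ‖ ≤ 1 + γ := by
  refine norm_add_le_of_le (norm_le_one_of_comp_adjoint h.PP) ?_
  rw [norm_smul, Complex.norm_of_nonneg hγ.le]
  have := norm_le_one_of_comp_adjoint h.DD
  nlinarith

/-- The repulsion `U P*P` is non-negative and is dropped, so the bound does not involve `U`. It
yields a bound on `H` over negative spectral subspaces that is uniform in `U`. -/
theorem le_re_inner_coupledModel (h : IsChannelTriple P D B) {w τ : ℝ} (hγ : 0 < γ)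
    (hV : ‖V‖ ≤ w) (hT : ‖T‖ ≤ τ) (hhop : 0 < hop) (hhop1 : hop ≤ 1) (hU : 0 < U) (ψ : E) :
    -(2 * ((1 + γ) * w) + τ) * ‖ψ‖ ^ 2 ≤ (inner ℂ ψ (coupledModel P D B V T γ hop U ψ)).re := by
  have hw : 0 ≤ w := (norm_nonneg _).trans hV
  have hτ : 0 ≤ τ := (norm_nonneg _).trans hT
  have e : (inner ℂ ψ (coupledModel P D B V T γ hop U ψ)).re =
      U * ‖P ψ‖ ^ 2 + (inner ℂ (pairChannel P D γ ψ) (V (B ψ))).re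
        + (inner ℂ (B ψ) (V (pairChannel P D γ ψ))).re + hop * (inner ℂ ψ (T ψ)).re := by
    simp only [coupledModel, add_apply, smul_apply, comp_apply, inner_add_right, inner_smul_right,
      adjoint_inner_right, Complex.add_re, Complex.re_ofReal_mul, inner_self_eq_norm_sq_to_K]
    rw [← add_assoc]
    congr 4
    norm_cast
  have hBn : ‖B ψ‖ ≤ ‖ψ‖ := by
    simpa using B.le_of_opNorm_le (norm_le_one_of_comp_adjoint h.BB) ψ
  have hcn : ‖pairChannel P D γ ψ‖ ≤ (1 + γ) * ‖ψ‖ :=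
    (pairChannel P D γ).le_of_opNorm_le (h.norm_pairChannel_le hγ) ψ
  have h1 : |(inner ℂ (pairChannel P D γ ψ) (V (B ψ))).re| ≤ (1 + γ) * w * ‖ψ‖ ^ 2 :=
    calc _ ≤ ‖pairChannel P D γ ψ‖ * ‖V (B ψ)‖ :=
          (Complex.abs_re_le_norm _).trans (norm_inner_le_norm _ _)
      _ ≤ ((1 + γ) * ‖ψ‖) * (w * ‖ψ‖) := by
          gcongr; exact V.le_of_opNorm_le_of_le hV hBn
      _ = _ := by ring
  have h2 : |(inner ℂ (B ψ) (V (pairChannel P D γ ψ))).re| ≤ (1 + γ) * w * ‖ψ‖ ^ 2 :=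
    calc _ ≤ ‖B ψ‖ * ‖V (pairChannel P D γ ψ)‖ :=
          (Complex.abs_re_le_norm _).trans (norm_inner_le_norm _ _)
      _ ≤ ‖ψ‖ * (w * ((1 + γ) * ‖ψ‖)) := by
          gcongr; exact V.le_of_opNorm_le_of_le hV hcn
      _ = _ := by ring
  have h3 : |(inner ℂ ψ (T ψ)).re| ≤ τ * ‖ψ‖ ^ 2 :=
    calc _ ≤ ‖ψ‖ * ‖T ψ‖ := (Complex.abs_re_le_norm _).trans (norm_inner_le_norm _ _)
      _ ≤ ‖ψ‖ * (τ * ‖ψ‖) := by gcongr; exact T.le_of_opNorm_le hT ψ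
      _ = _ := by ring
  have h4 : -(τ * ‖ψ‖ ^ 2) ≤ hop * (inner ℂ ψ (T ψ)).re := by
    have h5 : 0 ≤ τ * ‖ψ‖ ^ 2 := by positivity
    have h6 := (abs_le.1 h3).1
    nlinarith
  have h7 : 0 ≤ U * ‖P ψ‖ ^ 2 := by positivity
  rw [e]
  linarith [(abs_le.1 h1).1, (abs_le.1 h2).1]

/-- The coupling produces a bound state of negative energy. -/
theorem exists_groundEnergy_le (h : IsChannelTriple P D B) {τ : ℝ} (hγ : 0 < γ)
    (hV : IsSelfAdjoint V) (hV0 : V ≠ 0) (hT : IsSelfAdjoint T) (hTτ : ‖T‖ ≤ τ) :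
    ∃ e > 0, ∀ hop U : ℝ, 0 < hop →
      groundEnergy (coupledModel P D B V T γ hop U) ≤ -e + hop * τ := by
  obtain ⟨g, hg⟩ : ∃ g, V g ≠ 0 := by
    by_contra! hcon
    exact hV0 (ContinuousLinearMap.ext hcon)
  -- The trial state has no doubly occupied component, hence its energy does not see `U`; the
  -- relative sign makes the exchange energy equal to `-2γ ‖V g‖²`.
  set ψ : E := adjoint B g - adjoint D (V g) with hψ
  have e1 (χ : K) : P (adjoint D χ) = 0 := DFunLike.congr_fun h.PD χ
  have e2 (χ : K) : P (adjoint B χ) = 0 := DFunLike.congr_fun h.PB χ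
  have e3 (χ : K) : D (adjoint D χ) = χ := DFunLike.congr_fun h.DD χ
  have e4 (χ : K) : D (adjoint B χ) = 0 := DFunLike.congr_fun h.DB χ
  have e5 (χ : K) : B (adjoint D χ) = 0 := DFunLike.congr_fun (comp_adjoint_swap h.DB) χ
  have e6 (χ : K) : B (adjoint B χ) = χ := DFunLike.congr_fun h.BB χ
  have hPψ : P ψ = 0 := by simp [hψ, e1, e2]
  have hDψ : D ψ = -V g := by simp [hψ, e3, e4]
  have hBψ : B ψ = g := by simp [hψ, e5, e6]
  have hcψ : pairChannel P D γ ψ = -((γ : ℂ) • V g) := by simp [pairChannel, hPψ, hDψ]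
  have hψ0 : 0 < ‖ψ‖ := by
    rw [norm_pos_iff]
    rintro h0
    rw [h0, map_zero] at hDψ
    exact hg (by simpa using hDψ.symm)
  have hVg : 0 < ‖V g‖ := norm_pos_iff.2 hg
  refine ⟨2 * γ * ‖V g‖ ^ 2 / ‖ψ‖ ^ 2, by positivity, fun hop U hhop => ?_⟩
  have hg1 := groundEnergy_mul_le
    (isSelfAdjoint_coupledModel (P := P) (D := D) (B := B) (γ := γ) (hop := hop) (U := U) hV hT) ψ
  have hVV : inner ℂ g (V (V g)) = inner ℂ (V g) (V g) := by
    rw [← adjoint_inner_left, isSelfAdjoint_iff'.1 hV]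
  have e : (inner ℂ ψ (coupledModel P D B V T γ hop U ψ)).re =
      -(2 * γ * ‖V g‖ ^ 2) + hop * (inner ℂ ψ (T ψ)).re := by
    simp only [coupledModel, add_apply, smul_apply, comp_apply, inner_add_right, inner_smul_right,
      adjoint_inner_right, Complex.add_re, Complex.re_ofReal_mul, hPψ, hBψ, hcψ, inner_zero_left,
      map_neg, map_smul, inner_neg_left, inner_neg_right, inner_smul_left, hVV, Complex.conj_ofReal,
      Complex.neg_re, Complex.zero_re]
    rw [inner_self_eq_norm_sq_to_K]
    have : (((‖V g‖ : ℝ) : ℂ) ^ 2).re = ‖V g‖ ^ 2 := by norm_cast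
    simp only [Complex.coe_algebraMap, this]
    ring
  have h3 : (inner ℂ ψ (T ψ)).re ≤ τ * ‖ψ‖ ^ 2 :=
    calc _ ≤ ‖ψ‖ * ‖T ψ‖ := (Complex.re_le_norm _).trans (norm_inner_le_norm _ _)
      _ ≤ ‖ψ‖ * (τ * ‖ψ‖) := by gcongr; exact T.le_of_opNorm_le hTτ ψ
      _ = _ := by ring
  have h4 : hop * (inner ℂ ψ (T ψ)).re ≤ hop * (τ * ‖ψ‖ ^ 2) := by gcongr
  have h5 : groundEnergy (coupledModel P D B V T γ hop U) * ‖ψ‖ ^ 2 ≤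
      (-(2 * γ * ‖V g‖ ^ 2 / ‖ψ‖ ^ 2) + hop * τ) * ‖ψ‖ ^ 2 := by
    rw [add_mul, neg_mul, div_mul_cancel₀ _ (by positivity)]
    linarith
  exact le_of_mul_le_mul_right h5 (by positivity)

/-- The different kinetic energies `T` and `T'` are harmless because both carry the factor `hop`.
All constants are fixed before `hop` and `U`, so the estimate is uniform in them. -/
theorem exists_norm_propagator_sub_le [Nontrivial E] (h : IsChannelTriple P D B)
    {A : K →L[ℂ] K} {T' : E →L[ℂ] E} (hγ : 0 < γ) (hV : IsSelfAdjoint V) (hA : IsSelfAdjoint A)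
    (hT : IsSelfAdjoint T) (hT' : IsSelfAdjoint T') (hVA : V * A = A * V) (hAA : A * A = V * V)
    (hA0 : ∀ χ, 0 ≤ (inner ℂ χ (A χ)).re) :
    ∃ C : ℝ, ∀ hop U : ℝ, 0 < hop → 0 < U → ∀ H Ht : E →L[ℂ] E,
      H = coupledModel P D B V T γ hop U →
      Ht = uncoupledModel P D B
        (((γ⁻¹ : ℝ) : ℂ) • A - ((γ⁻¹ ^ 2 / (2 * U + 1) : ℝ) : ℂ) • (V * V))
        ((γ : ℂ) • A + ((1 / (2 * U) : ℝ) : ℂ) • (V * V)) T' γ hop U →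
      IsSelfAdjoint H ∧ IsSelfAdjoint Ht ∧ ∀ ε : ℝ, 0 < ε → ε < 1 / 2 → ∀ t : ℝ,
        ‖(propagator H t - propagator Ht t) ∘L
            spectralProjection H (groundEnergy H) (groundEnergy H * (1 - ε))‖
          ≤ C * ((1 + |t|) * (hop + (U ^ 2)⁻¹)) := by
  have hVV : IsSelfAdjoint (V * V) := by
    rw [isSelfAdjoint_iff', ← star_eq_adjoint, star_mul, hV.star_eq]
  have hsa (hop U : ℝ) : IsSelfAdjoint (coupledModel P D B V T γ hop U) :=
    isSelfAdjoint_coupledModel hV hT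
  have hsa' (hop U : ℝ) : IsSelfAdjoint (uncoupledModel P D B
        (((γ⁻¹ : ℝ) : ℂ) • A - ((γ⁻¹ ^ 2 / (2 * U + 1) : ℝ) : ℂ) • (V * V))
        ((γ : ℂ) • A + ((1 / (2 * U) : ℝ) : ℂ) • (V * V)) T' γ hop U) :=
    isSelfAdjoint_uncoupledModel
      ((isSelfAdjoint_real_smul _ hA).sub (isSelfAdjoint_real_smul _ hVV))
      ((isSelfAdjoint_real_smul _ hA).add (isSelfAdjoint_real_smul _ hVV)) hT'
  have hdiff (hop U : ℝ) (ψ : E) : (coupledModel P D B V T γ hop U - uncoupledModel P D B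
        (((γ⁻¹ : ℝ) : ℂ) • A - ((γ⁻¹ ^ 2 / (2 * U + 1) : ℝ) : ℂ) • (V * V))
        ((γ : ℂ) • A + ((1 / (2 * U) : ℝ) : ℂ) • (V * V)) T' γ hop U) ψ =
      adjoint (pairChannel P D γ) (((γ⁻¹ : ℝ) : ℂ) • A (P ψ + (γ : ℂ) • D ψ)
          - ((γ⁻¹ ^ 2 / (2 * U + 1) : ℝ) : ℂ) • V (V (P ψ + (γ : ℂ) • D ψ)) + V (B ψ))
      + adjoint B (((γ : ℂ) • A (B ψ) + ((1 / (2 * U) : ℝ) : ℂ) • V (V (B ψ)))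
          + V (P ψ + (γ : ℂ) • D ψ)) + (hop : ℂ) • (T - T') ψ := by
    have e : pairChannel P D γ ψ = P ψ + (γ : ℂ) • D ψ := rfl
    rw [← e]
    simp only [coupledModel, uncoupledModel, add_apply, sub_apply, smul_apply, comp_apply,
      mul_apply_eq_comp, map_add, map_sub, map_smul, smul_sub]
    abel
  -- Smallness may be assumed: when `hop + U⁻²` exceeds `δ`, the trivial bound 2 is at most `2 / δ`
  -- times it, whatever the spectral interval is.
  suffices hmain : ∃ C : ℝ, 0 ≤ C ∧ ∃ δ > 0, ∀ hop U : ℝ, 0 < hop → 0 < U → hop + (U ^ 2)⁻¹ ≤ δ →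
      ∀ ε : ℝ, 0 < ε → ε < 1 / 2 →
      ∀ ψ ∈ spectralSubspace (coupledModel P D B V T γ hop U)
        (groundEnergy (coupledModel P D B V T γ hop U))
        (groundEnergy (coupledModel P D B V T γ hop U) * (1 - ε)),
        ‖(coupledModel P D B V T γ hop U - uncoupledModel P D B
        (((γ⁻¹ : ℝ) : ℂ) • A - ((γ⁻¹ ^ 2 / (2 * U + 1) : ℝ) : ℂ) • (V * V))
        ((γ : ℂ) • A + ((1 / (2 * U) : ℝ) : ℂ) • (V * V)) T' γ hop U) ψ‖ ≤
          (C * (hop + (U ^ 2)⁻¹)) * ‖ψ‖ by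
    obtain ⟨C, hC, δ, hδ, hmain⟩ := hmain
    refine ⟨max C (2 / δ), fun hop U hhop hU H Ht hH hHt => ?_⟩
    subst hH hHt
    refine ⟨hsa hop U, hsa' hop U, fun ε hε hε2 t => ?_⟩
    have hη : 0 < hop + (U ^ 2)⁻¹ := by positivity
    rcases le_or_gt (hop + (U ^ 2)⁻¹) δ with hle | hgt
    · refine (norm_propagator_sub_comp_spectralProjection_le (hsa hop U) (hsa' hop U)
        (by positivity) (hmain hop U hhop hU hle ε hε hε2) t).trans ?_
      calc C * (hop + (U ^ 2)⁻¹) * |t| ≤ max C (2 / δ) * (hop + (U ^ 2)⁻¹) * (1 + |t|) := by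
            gcongr
            · exact le_max_left _ _
            · linarith
        _ = _ := by ring
    · refine (norm_propagator_sub_comp_spectralProjection_le_two (hsa hop U) (hsa' hop U)
        _ _ t).trans ?_
      calc (2 : ℝ) = 2 / δ * (1 * δ) := by field_simp
        _ ≤ max C (2 / δ) * ((1 + |t|) * (hop + (U ^ 2)⁻¹)) := by
          gcongr
          · exact le_max_right _ _
          · linarith [abs_nonneg t]
  have hTT (ψ : E) : ‖(T - T') ψ‖ ≤ ‖T - T'‖ * ‖ψ‖ := (T - T').le_opNorm ψ
  -- Without coupling there need not be any negative energy, so this case is separate; `A² = V² = 0`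
  -- with `A` self-adjoint removes the effective interactions as well.
  by_cases hV0 : V = 0
  · have hA00 : A = 0 := by
      have : star A * A = 0 := by rw [hA.star_eq, hAA, hV0, mul_zero]
      exact CStarRing.star_mul_self_eq_zero_iff A |>.1 this
    refine ⟨‖T - T'‖, norm_nonneg _, 1, one_pos, fun hop U hhop hU _ ε _ _ ψ _ => ?_⟩
    rw [hdiff]
    simp only [hV0, hA00, zero_apply, smul_zero, sub_zero, add_zero, map_zero, zero_add]
    rw [norm_smul, Complex.norm_of_nonneg hhop.le]
    calc hop * ‖(T - T') ψ‖ ≤ (hop + (U ^ 2)⁻¹) * (‖T - T'‖ * ‖ψ‖) := by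
          gcongr
          · exact le_add_of_nonneg_right (by positivity)
          · exact hTT ψ
      _ = _ := by ring
  · obtain ⟨e, he, hground⟩ := h.exists_groundEnergy_le hγ hV hV0 hT le_rfl
    set w := max ‖V‖ ‖A‖ with hw
    set τ := ‖T‖ with hτ
    -- Half of `e` is lost to the hopping energy, and another half to the factor `1 - ε ≥ 1 / 2`.
    set m := e / 4 with hm
    set M := 2 * ((1 + γ) * w) + τ with hM
    have hw0 : 0 ≤ w := (norm_nonneg V).trans (le_max_left _ _)
    have hτ0 : 0 ≤ τ := norm_nonneg _
    have hM0 : 0 ≤ M := by positivity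
    have hm0 : 0 < m := by positivity
    obtain ⟨k, hk⟩ : ∃ k, k = w ^ 2 / m + 1 := ⟨_, rfl⟩
    have hk1 : 1 ≤ k := by rw [hk]; linarith [div_nonneg (sq_nonneg w) hm0.le]
    -- The first bound gives `U ≥ k`, hence `U ≥ 1` and `w² / U ≤ m`, and also `hop ≤ 1`. The second
    -- gives `hop * τ ≤ e / 2`.
    obtain ⟨δ, hδ⟩ : ∃ δ, δ = min (1 / k ^ 2) (e / (2 * (τ + 1))) := ⟨_, rfl⟩
    have hδ0 : 0 < δ := by rw [hδ]; positivity
    have hδk : δ ≤ 1 / k ^ 2 := hδ ▸ min_le_left _ _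
    have hδe : δ ≤ e / (2 * (τ + 1)) := hδ ▸ min_le_right _ _
    obtain ⟨c₁, hc₁⟩ : ∃ c, c = M + w + τ := ⟨_, rfl⟩
    obtain ⟨c₂, hc₂⟩ : ∃ c, c = c₁ * M + τ := ⟨_, rfl⟩
    obtain ⟨c₃, hc₃⟩ : ∃ c, c = w * (c₂ * M) + (γ * (w * τ) + τ * M) := ⟨_, rfl⟩
    obtain ⟨c₄, hc₄⟩ : ∃ c, c = c₃ + w * (w * (w * w)) := ⟨_, rfl⟩
    obtain ⟨c₅, hc₅⟩ : ∃ c, c = c₄ / (m / 2) := ⟨_, rfl⟩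
    obtain ⟨c₆, hc₆⟩ : ∃ c, c = γ * (w * c₅) + (τ * M + γ * (w * τ) + w * (w * τ)) := ⟨_, rfl⟩
    obtain ⟨c₇, hc₇⟩ : ∃ c, c = c₆ / m := ⟨_, rfl⟩
    obtain ⟨c₈, hc₈⟩ : ∃ c, c = γ⁻¹ * (w * c₂ + c₇ + τ + γ⁻¹ * (w * c₇) + γ⁻¹ * (w * τ)
      + γ⁻¹ * (w * (w * w)) + w * w + γ⁻¹ * (w * (w * c₁))) := ⟨_, rfl⟩
    -- The absolute value spares a proof that the accumulated constant is non-negative.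
    refine ⟨|(1 + γ) * c₈ + (c₅ + τ) + ‖T - T'‖|, abs_nonneg _, δ, hδ0,
      fun hop U hhop hU hle ε hε hε2 ψ hψ => ?_⟩
    have hUi : 0 < (U ^ 2)⁻¹ := by positivity
    have hkU : k ≤ U := by
      have h1 : (U ^ 2)⁻¹ ≤ (k ^ 2)⁻¹ := by rw [← one_div (k ^ 2)]; linarith
      have h2 := (inv_le_inv₀ (by positivity) (by positivity)).1 h1
      exact le_of_sq_le_sq h2 hU.le
    have hhop1 : hop ≤ 1 := by
      have : 1 / k ^ 2 ≤ 1 := by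
        rw [div_le_one (by positivity)]; exact one_le_pow₀ hk1
      linarith
    have hUw : w ^ 2 / U ≤ m := by
      rw [div_le_iff₀ hU]
      have : w ^ 2 / m ≤ U := by linarith
      rw [div_le_iff₀ hm0] at this
      linarith
    set H := coupledModel P D B V T γ hop U with hH
    have hE : groundEnergy H ≤ -(e / 2) := by
      refine (hground hop U hhop).trans ?_
      have h1 : hop * (2 * (τ + 1)) ≤ e := by
        rw [← le_div_iff₀ (by positivity)]; linarith
      have h2 : hop * (2 * (τ + 1)) = 2 * (hop * τ) + 2 * hop := by ring
      linarith
    have hEM : -M ≤ groundEnergy H := le_groundEnergy (hsa hop U) fun φ =>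
      h.le_re_inner_coupledModel hγ (le_max_left _ _) le_rfl hhop hhop1 hU φ
    have hb : groundEnergy H * (1 - ε) ≤ -m := by
      have h1 : groundEnergy H * (1 - ε) ≤ groundEnergy H * (1 / 2) :=
        mul_le_mul_of_nonpos_left (by linarith) (by linarith)
      linarith
    have hab : groundEnergy H ≤ groundEnergy H * (1 - ε) := by
      have h1 : groundEnergy H * 1 ≤ groundEnergy H * (1 - ε) :=
        mul_le_mul_of_nonpos_left (by linarith) (by linarith)
      linarith
    obtain ⟨k1, k2⟩ := norm_model_sub_apply_le (S := spectralSubspace H (groundEnergy H)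
        (groundEnergy H * (1 - ε))) (P := P) (D := D) (B := B) (V := V) (A := A) (H := H) (T := T)
      (γ := γ) (hop := hop) (U := U) (m := m) (M := M) (w := w) (τ := τ)
      (fun φ hφ => apply_mem_spectralSubspace hφ)
      (fun φ hφ => (re_inner_apply_le_of_mem_spectralSubspace (hsa hop U) hφ).trans
        (by gcongr))
      (fun φ hφ => norm_apply_le_of_mem_spectralSubspace (hsa hop U) hab hEM (by linarith) hφ)
      (norm_le_one_of_comp_adjoint h.PP) (norm_le_one_of_comp_adjoint h.DD)
      (norm_le_one_of_comp_adjoint h.BB) (le_max_left _ _) (le_max_right _ _) le_rfl hγ hm0 hM0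
      hhop hhop1 (hk1.trans hkU) hUw rfl (fun χ => DFunLike.congr_fun hVA χ)
      (fun χ => DFunLike.congr_fun hAA χ) hA0 h.P_coupledModel h.D_coupledModel h.B_coupledModel
      hc₁ hc₂ hc₃ hc₄ hc₅ hc₆ hc₇ ψ hψ
    rw [← hc₈] at k2
    rw [hdiff]
    have hcn : ‖adjoint (pairChannel P D γ)‖ ≤ 1 + γ := by
      rw [LinearIsometryEquiv.norm_map]; exact h.norm_pairChannel_le hγ
    have hBn : ‖adjoint B‖ ≤ 1 := by
      rw [LinearIsometryEquiv.norm_map]; exact norm_le_one_of_comp_adjoint h.BB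
    refine (norm_add_le_mul (norm_add_le_mul (norm_map_le_mul hcn k2)
      (norm_map_le_mul_of_norm_le_one hBn k1)) (norm_small_smul_le_mul
        (by rw [abs_of_pos hhop]; linarith) (hTT ψ))).trans ?_
    rw [← mul_assoc]
    gcongr
    exact le_abs_self _

end IsChannelTriple

end AbstractTheorem

/-! ### Pullbacks, translations and convolution operators on the lattice. -/

section Lattice

open ContinuousLinearMap

/-! ### Pullbacks on `ℓ²` -/

variable {α β δ : Type*}

theorem memℓp_comp_injective {j : α → β} (hj : Function.Injective j) (f : ℓ²(β, ℂ)) :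
    Memℓp (fun a => f (j a)) 2 := by
  refine memℓp_gen ?_
  exact ((lp.memℓp f).summable (by simp)).comp_injective hj

/-- The pullback of square-summable functions along an injective map. -/
noncomputable def pull (j : α → β) (hj : Function.Injective j) : ℓ²(β, ℂ) →L[ℂ] ℓ²(α, ℂ) :=
  LinearMap.mkContinuous
    { toFun := fun f => ⟨fun a => f (j a), memℓp_comp_injective hj f⟩
      map_add' := fun _ _ => rfl
      map_smul' := fun _ _ => rfl } 1 fun f => by
    rw [one_mul]
    refine lp.norm_le_of_tsum_le (by simp) (norm_nonneg _) ?_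
    rw [lp.norm_rpow_eq_tsum (by simp) f]
    exact tsum_comp_le_tsum_of_inj ((lp.memℓp f).summable (by simp))
      (fun b => by positivity) hj

@[simp]
theorem pull_apply (j : α → β) (hj : Function.Injective j) (f : ℓ²(β, ℂ)) (a : α) :
    pull j hj f a = f (j a) := rfl

theorem norm_pull_le (j : α → β) (hj : Function.Injective j) : ‖pull j hj‖ ≤ 1 :=
  LinearMap.mkContinuous_norm_le _ zero_le_one _

open scoped Classical in
theorem adjoint_apply_eq_inner (T : ℓ²(β, ℂ) →L[ℂ] ℓ²(α, ℂ)) (g : ℓ²(α, ℂ)) (b : β) :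
    adjoint T g b = inner ℂ (T (lp.single 2 b 1)) g := by
  rw [← adjoint_inner_right, lp.inner_single_left]
  simp

/-- The adjoint of a pullback along an injection is extension by zero; this lemma and the next give
its values on and off the range, by testing against delta functions. -/
theorem adjoint_pull_apply (j : α → β) (hj : Function.Injective j) (g : ℓ²(α, ℂ)) (a : α) :
    adjoint (pull j hj) g (j a) = g a := by
  classical
  have : pull j hj (lp.single 2 (j a) 1) = lp.single 2 a 1 := by
    ext a'
    simp [Pi.single_apply, hj.eq_iff]
  rw [adjoint_apply_eq_inner, this, lp.inner_single_left]
  simp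

theorem adjoint_pull_apply_of_forall_ne (j : α → β) (hj : Function.Injective j) (g : ℓ²(α, ℂ))
    {b : β} (hb : ∀ a, j a ≠ b) : adjoint (pull j hj) g b = 0 := by
  classical
  have : pull j hj (lp.single 2 b 1) = 0 := by
    ext a'
    simp [hb]
  rw [adjoint_apply_eq_inner, this, inner_zero_left]

theorem pull_comp_adjoint_self (j : α → β) (hj : Function.Injective j) :
    pull j hj ∘L adjoint (pull j hj) = 1 := by
  ext g a
  simp [adjoint_pull_apply]

theorem pull_comp_adjoint_of_disjoint {j : α → β} (hj : Function.Injective j) {i : δ → β}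
    (hi : Function.Injective i) (h : ∀ a d, i d ≠ j a) :
    pull j hj ∘L adjoint (pull i hi) = 0 := by
  ext g a
  simp [adjoint_pull_apply_of_forall_ne i hi g (h a)]

/-- Translation by `x` on `ℓ²` of an additive group. -/
noncomputable def shift {G : Type*} [AddGroup G] (x : G) : ℓ²(G, ℂ) →L[ℂ] ℓ²(G, ℂ) :=
  pull (fun y => y - x) (sub_left_injective)

@[simp]
theorem shift_apply {G : Type*} [AddGroup G] (x y : G) (f : ℓ²(G, ℂ)) :
    shift x f y = f (y - x) := rfl

theorem shift_zero {G : Type*} [AddGroup G] : shift (0 : G) = 1 := by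
  ext f y; simp

theorem shift_mul_shift {G : Type*} [AddCommGroup G] (x y : G) :
    shift x * shift y = shift (x + y) := by
  ext f z; simp [sub_sub]

theorem star_shift {G : Type*} [AddCommGroup G] (x : G) : star (shift x) = shift (-x) := by
  ext f z
  have := adjoint_pull_apply (fun y => y - x) sub_left_injective f (z + x)
  simp only [add_sub_cancel_right] at this
  rw [star_eq_adjoint, shift, this]
  simp

theorem norm_shift_le {G : Type*} [AddGroup G] (x : G) : ‖shift x‖ ≤ 1 := norm_pull_le _ _

/-! ### Summable combinations of translations, in any complete normed algebra. -/

section Representation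

variable {R : Type*} [NormedRing R] [NormedAlgebra ℂ R] {s : Site → R}

/-- The image of a summable function under a representation of the lattice. -/
noncomputable def repSum (s : Site → R) (v : Site → ℝ) : R := ∑' x, (v x : ℂ) • s x

theorem summable_norm_smul_rep (hs : ∀ x, ‖s x‖ ≤ 1) {v : Site → ℝ} (hv : Summable v) :
    Summable fun x => ‖(v x : ℂ) • s x‖ := by
  refine Summable.of_nonneg_of_le (fun _ => norm_nonneg _) (fun x => ?_) hv.norm
  rw [norm_smul, Complex.norm_real]
  nlinarith [norm_nonneg (v x), hs x]

theorem repSum_smul (c : ℝ) (v : Site → ℝ) : repSum s (c • v) = (c : ℂ) • repSum s v := by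
  rw [repSum, repSum, ← tsum_const_smul'']
  simp only [Pi.smul_apply, smul_eq_mul, Complex.ofReal_mul, smul_smul]

variable [CompleteSpace R]

theorem summable_smul_rep (hs : ∀ x, ‖s x‖ ≤ 1) {v : Site → ℝ} (hv : Summable v) :
    Summable fun x => (v x : ℂ) • s x :=
  (summable_norm_smul_rep hs hv).of_norm

theorem repSum_add (hs : ∀ x, ‖s x‖ ≤ 1) {v w : Site → ℝ} (hv : Summable v) (hw : Summable w) :
    repSum s (v + w) = repSum s v + repSum s w := by
  rw [repSum, repSum, repSum, ← (summable_smul_rep hs hv).tsum_add (summable_smul_rep hs hw)]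
  simp [add_smul]

theorem repSum_sub (hs : ∀ x, ‖s x‖ ≤ 1) {v w : Site → ℝ} (hv : Summable v) (hw : Summable w) :
    repSum s (v - w) = repSum s v - repSum s w := by
  rw [repSum, repSum, repSum, ← (summable_smul_rep hs hv).tsum_sub (summable_smul_rep hs hw)]
  simp [sub_smul]

/-- The bijection `(x, y) ↦ (x - y, y)`. -/
def subEquiv : Site × Site ≃ Site × Site where
  toFun p := (p.1 - p.2, p.2)
  invFun p := (p.1 + p.2, p.2)
  left_inv p := by simp
  right_inv p := by simp

theorem summable_conv_kernel {v w : Site → ℝ} (hv : Summable v) (hw : Summable w) :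
    Summable fun p : Site × Site => v (p.1 - p.2) * w p.2 :=
  subEquiv.summable_iff.2 (summable_mul_of_summable_norm hv.norm hw.norm)

theorem summable_conv {v w : Site → ℝ} (hv : Summable v) (hw : Summable w) :
    Summable (conv v w) :=
  (summable_conv_kernel hv hw).prod

/-- The product is an absolutely convergent double sum; the change of variables `(x, y) ↦ (x - y,
y)` followed by Fubini collects the terms with equal translation. -/
theorem repSum_conv (hs : ∀ x, ‖s x‖ ≤ 1) (hmul : ∀ x y, s x * s y = s (x + y)) {v w : Site → ℝ}
    (hv : Summable v) (hw : Summable w) : repSum s (conv v w) = repSum s v * repSum s w := by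
  have h1 : Summable fun p : Site × Site => ((v p.1 : ℂ) • s p.1) * ((w p.2 : ℂ) • s p.2) :=
    summable_mul_of_summable_norm (f := fun x => (v x : ℂ) • s x) (g := fun x => (w x : ℂ) • s x)
      (summable_norm_smul_rep hs hv) (summable_norm_smul_rep hs hw)
  have he (p : Site × Site) :
      ((v (subEquiv p).1 : ℂ) • s (subEquiv p).1) * ((w (subEquiv p).2 : ℂ) •
        s (subEquiv p).2) = ((v (p.1 - p.2) * w p.2 : ℝ) : ℂ) • s p.1 := by
    rw [smul_mul_smul_comm, hmul]
    simp [subEquiv]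
  have h2 : Summable fun p : Site × Site => ((v (p.1 - p.2) * w p.2 : ℝ) : ℂ) • s p.1 := by
    simp only [← he]
    exact subEquiv.summable_iff.2 h1
  rw [repSum, repSum, repSum, tsum_mul_tsum_of_summable_norm (summable_norm_smul_rep hs hv)
    (summable_norm_smul_rep hs hw), ← subEquiv.tsum_eq]
  simp only [he]
  rw [h2.tsum_prod]
  refine tsum_congr fun x => ?_
  have hx : Summable fun y => ((v (x - y) * w y : ℝ) : ℂ) :=
    Complex.summable_ofReal.2 ((summable_conv_kernel hv hw).prod_factor x)
  rw [conv, Complex.ofReal_tsum]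
  exact (hx.tsum_smul_const (s x)).symm

end Representation

/-- A character of `ℤ` is determined by its value `exp(iθ)` at 1. The choice `k = -θ` matches the
sign convention of `fourier`. -/
theorem exists_zpow_of_character (χ : ℤ → ℂ) (h0 : χ 0 = 1) (h : ∀ a b, χ (a + b) = χ a * χ b)
    (h1 : ‖χ 1‖ = 1) : ∃ k : ℝ, ∀ n : ℤ, χ n = Complex.exp (-(Complex.I * ((k * n : ℝ) : ℂ))) := by
  obtain ⟨θ, hθ⟩ := (Complex.norm_eq_one_iff (χ 1)).1 h1
  have hne : χ 1 ≠ 0 := by rw [← hθ]; exact Complex.exp_ne_zero _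
  have hz (n : ℤ) : χ n = χ 1 ^ n := by
    induction n using Int.induction_on with
    | zero => simpa using h0
    | succ n ih => rw [h, ih, zpow_add_one₀ hne]
    | pred n ih =>
      have := h (-(n : ℤ) - 1) 1
      rw [sub_add_cancel, ih] at this
      rw [zpow_sub_one₀ hne, this]
      field_simp
  refine ⟨-θ, fun n => ?_⟩
  rw [hz, ← hθ, ← Complex.exp_int_mul]
  congr 1
  push_cast
  ring

/-! ### Fourier transforms as Gelfand transforms. -/

section Gelfand

open WeakDual

variable {𝒜 : Type*} [CommCStarAlgebra 𝒜]

/-- Under the Gelfand isomorphism `a` is a non-negative continuous function, and `b` is its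
continuous square root. -/
theorem eq_star_mul_self_of_characters {a : 𝒜}
    (h : ∀ φ : characterSpace ℂ 𝒜, 0 ≤ (φ a).re ∧ (φ a).im = 0) : ∃ b, a = star b * b := by
  set g := gelfandStarTransform 𝒜 a with hg
  let s : C(characterSpace ℂ 𝒜, ℂ) :=
    ⟨fun φ => ((Real.sqrt (g φ).re : ℝ) : ℂ), by fun_prop⟩
  refine ⟨(gelfandStarTransform 𝒜).symm s, EquivLike.injective (gelfandStarTransform 𝒜) ?_⟩
  rw [map_mul, map_star, StarAlgEquiv.apply_symm_apply, ← hg]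
  ext φ
  have h1 : g φ = φ a := rfl
  obtain ⟨h2, h3⟩ := h φ
  simp only [ContinuousMap.mul_apply, ContinuousMap.star_apply, s, ContinuousMap.coe_mk, h1]
  rw [RCLike.star_def, Complex.conj_ofReal, ← Complex.ofReal_mul, Real.mul_self_sqrt h2]
  exact Complex.ext rfl h3

theorem eq_zero_of_characters {a : 𝒜} (h : ∀ φ : characterSpace ℂ 𝒜, φ a = 0) : a = 0 := by
  apply EquivLike.injective (gelfandStarTransform 𝒜)
  rw [map_zero]
  ext φ
  exact h φ

variable {s : Site → 𝒜}

/-- Composing `φ` with the translations gives a unimodular character of `ℤ²`, that is, a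
quasi-momentum in each coordinate. Only this direction is needed to pass from pointwise facts about
Fourier transforms to operators; not every `k` has to arise. -/
theorem exists_character_repSum (hmul : ∀ x y, s x * s y = s (x + y)) (h0 : s 0 = 1)
    (hstar : ∀ x, star (s x) = s (-x)) (hs : ∀ x, ‖s x‖ ≤ 1) (φ : characterSpace ℂ 𝒜) :
    ∃ k : ℝ × ℝ, ∀ v : Site → ℝ, Summable v → φ (repSum s v) = fourier v k := by
  have hmul (x y : Site) : φ (s (x + y)) = φ (s x) * φ (s y) := by
    rw [← hmul, map_mul]
  have hzero : φ (s 0) = 1 := by rw [h0, map_one]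
  have hnorm (x : Site) : ‖φ (s x)‖ = 1 := by
    have h1 : star (φ (s x)) * φ (s x) = 1 := by
      rw [← map_star, hstar, ← hmul, neg_add_cancel, hzero]
    have h2 := congrArg norm h1
    rw [norm_mul, norm_star, norm_one] at h2
    nlinarith [norm_nonneg (φ (s x))]
  obtain ⟨k₁, hk₁⟩ := exists_zpow_of_character (fun n => φ (s (n, 0))) hzero
    (fun a b => by rw [← hmul]; simp) (hnorm _)
  obtain ⟨k₂, hk₂⟩ := exists_zpow_of_character (fun n => φ (s (0, n))) hzero
    (fun a b => by rw [← hmul]; simp) (hnorm _)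
  refine ⟨(k₁, k₂), fun v hv => ?_⟩
  have h1 := (summable_smul_rep hs hv).hasSum.map φ (map_continuous φ)
  have h2 : φ (repSum s v) = _ := h1.tsum_eq.symm
  rw [h2, fourier]
  refine tsum_congr fun x => ?_
  have e : s x = s ((x.1, 0) + (0, x.2)) := by simp
  rw [Function.comp_apply, map_smul, e, hmul, smul_eq_mul, hk₁ x.1, hk₂ x.2, ← Complex.exp_add,
    mul_comm]
  congr 2
  push_cast
  ring

theorem repSum_eq_star_mul_self (hmul : ∀ x y, s x * s y = s (x + y)) (h0 : s 0 = 1)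
    (hstar : ∀ x, star (s x) = s (-x)) (hs : ∀ x, ‖s x‖ ≤ 1) {v : Site → ℝ} (hv : Summable v)
    (hpos : IsPositiveType v) : ∃ b, repSum s v = star b * b := by
  refine eq_star_mul_self_of_characters fun φ => ?_
  obtain ⟨k, hk⟩ := exists_character_repSum hmul h0 hstar hs φ
  rw [hk v hv]
  exact hpos k

theorem repSum_mul_eq_zero (hmul : ∀ x y, s x * s y = s (x + y)) (h0 : s 0 = 1)
    (hstar : ∀ x, star (s x) = s (-x)) (hs : ∀ x, ‖s x‖ ≤ 1) {v w : Site → ℝ} (hv : Summable v)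
    (hw : Summable w) (h : ∀ k, fourier v k * fourier w k = 0) : repSum s v * repSum s w = 0 := by
  refine eq_zero_of_characters fun φ => ?_
  obtain ⟨k, hk⟩ := exists_character_repSum hmul h0 hstar hs φ
  rw [map_mul, hk v hv, hk w hw]
  exact h k

end Gelfand

/-! ### The commutative C⋆-algebra generated by the translations -/

/-- The C⋆-algebra generated by the translations of the lattice. -/
noncomputable def shiftAlgebra : StarSubalgebra ℂ (ℓ²(Site, ℂ) →L[ℂ] ℓ²(Site, ℂ)) :=
  (StarAlgebra.adjoin ℂ (Set.range (shift (G := Site)))).topologicalClosure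

/-- Translations commute with each other and with their adjoints, which are again translations;
commutativity passes to the closure. -/
theorem shiftAlgebra_mul_comm (a b : shiftAlgebra) : a * b = b * a := by
  have h := StarAlgebra.isMulCommutative_adjoin ℂ (s := Set.range (shift (G := Site)))
    (by
      rintro _ ⟨x, rfl⟩ _ ⟨y, rfl⟩
      rw [shift_mul_shift, shift_mul_shift, add_comm])
    (by
      rintro _ ⟨x, rfl⟩ _ ⟨y, rfl⟩
      rw [star_shift, shift_mul_shift, shift_mul_shift, add_comm])
  exact (StarSubalgebra.commRingTopologicalClosure _
    (fun x y => h.is_comm.comm x y)).mul_comm a b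

noncomputable instance : NormedCommRing shiftAlgebra :=
  { SubringClass.toNormedRing shiftAlgebra with
    mul_comm := shiftAlgebra_mul_comm }

instance : CompleteSpace shiftAlgebra :=
  (StarSubalgebra.isClosed_topologicalClosure _).completeSpace_coe

noncomputable instance : CommCStarAlgebra shiftAlgebra where

theorem shift_mem_shiftAlgebra (x : Site) : shift x ∈ shiftAlgebra :=
  StarSubalgebra.le_topologicalClosure _ (StarAlgebra.subset_adjoin ℂ _ ⟨x, rfl⟩)

/-- Translation as an element of the algebra of translations. -/
noncomputable def shiftA (x : Site) : shiftAlgebra := ⟨shift x, shift_mem_shiftAlgebra x⟩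

theorem shiftA_mul (x y : Site) : shiftA x * shiftA y = shiftA (x + y) :=
  Subtype.ext (shift_mul_shift x y)

theorem shiftA_zero : shiftA 0 = 1 := Subtype.ext shift_zero

theorem star_shiftA (x : Site) : star (shiftA x) = shiftA (-x) := Subtype.ext (star_shift x)

theorem norm_shiftA_le (x : Site) : ‖shiftA x‖ ≤ 1 := norm_shift_le x

/-! ### Convolution operators -/

/-- The convolution by a summable function, as an operator on `ℓ²`. -/
noncomputable def convOp (v : Site → ℝ) : ℓ²(Site, ℂ) →L[ℂ] ℓ²(Site, ℂ) := repSum shift v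

theorem convOp_conv {v w : Site → ℝ} (hv : Summable v) (hw : Summable w) :
    convOp (conv v w) = convOp v * convOp w :=
  repSum_conv norm_shift_le shift_mul_shift hv hw

theorem hasSum_convOp_apply {v : Site → ℝ} (hv : Summable v) (f : ℓ²(Site, ℂ)) (y : Site) :
    HasSum (fun x => (v x : ℂ) * f (y - x)) (convOp v f y) := by
  have h1 := (summable_smul_rep (s := shift) norm_shift_le hv).hasSum
  have h3 := h1.mapL (ContinuousLinearMap.apply ℂ (ℓ²(Site, ℂ)) f)
  exact h3.mapL (lp.evalCLM ℂ (fun _ : Site => ℂ) 2 y)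

theorem convOp_apply {v : Site → ℝ} (hv : Summable v) (f : ℓ²(Site, ℂ)) (y : Site) :
    convOp v f y = ∑' x, (v (y - x) : ℂ) * f x := by
  rw [← (hasSum_convOp_apply hv f y).tsum_eq, ← (Equiv.subLeft y).tsum_eq]
  simp [Equiv.subLeft_apply]

theorem coe_repSum_shiftA {v : Site → ℝ} (hv : Summable v) :
    ((repSum shiftA v : shiftAlgebra) : ℓ²(Site, ℂ) →L[ℂ] ℓ²(Site, ℂ)) = convOp v := by
  have h1 := (summable_smul_rep (s := shiftA) norm_shiftA_le hv).hasSum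
  have h2 := h1.mapL (shiftAlgebra.toSubalgebra.toSubmodule.subtypeL)
  exact h2.unique (summable_smul_rep (s := shift) norm_shift_le hv).hasSum

theorem convOp_eq_star_mul_self {v : Site → ℝ} (hv : Summable v) (hpos : IsPositiveType v) :
    ∃ b, convOp v = star b * b := by
  obtain ⟨b, hb⟩ := repSum_eq_star_mul_self shiftA_mul shiftA_zero star_shiftA norm_shiftA_le hv
    hpos
  refine ⟨b, ?_⟩
  rw [← coe_repSum_shiftA hv, hb]
  rfl

theorem convOp_mul_eq_zero {v w : Site → ℝ} (hv : Summable v) (hw : Summable w)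
    (h : ∀ k, fourier v k * fourier w k = 0) : convOp v * convOp w = 0 := by
  rw [← coe_repSum_shiftA hv, ← coe_repSum_shiftA hw]
  exact congrArg Subtype.val
    (repSum_mul_eq_zero shiftA_mul shiftA_zero star_shiftA norm_shiftA_le hv hw h)

theorem convOp_mul_comm {v w : Site → ℝ} (hv : Summable v) (hw : Summable w) :
    convOp v * convOp w = convOp w * convOp v := by
  rw [← coe_repSum_shiftA hv, ← coe_repSum_shiftA hw]
  exact congrArg Subtype.val (shiftAlgebra_mul_comm (repSum shiftA v) (repSum shiftA w))

theorem isSelfAdjoint_convOp {v : Site → ℝ} (hv : Summable v) (hpos : IsPositiveType v) :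
    IsSelfAdjoint (convOp v) := by
  obtain ⟨b, hb⟩ := convOp_eq_star_mul_self hv hpos
  rw [hb]
  exact IsSelfAdjoint.star_mul_self b

theorem re_inner_convOp_nonneg {v : Site → ℝ} (hv : Summable v) (hpos : IsPositiveType v)
    (χ : ℓ²(Site, ℂ)) : 0 ≤ (inner ℂ χ (convOp v χ)).re := by
  obtain ⟨b, hb⟩ := convOp_eq_star_mul_self hv hpos
  rw [hb, star_eq_adjoint, mul_apply_eq_comp, adjoint_inner_right]
  exact inner_self_nonneg (𝕜 := ℂ)

end Lattice

/-! ### Second-quantized operators on states of one pair or one boson. -/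

section Fock

/-! ### Few-particle wave functions -/

/-- The state with `c` times the vacuum. -/
def vacuumFn (c : ℂ) : FockFn
  | 0, 0, _, _ => c
  | _, _, _, _ => 0

/-- The one-fermion state with wave function `f`. -/
def fermionFn (f : Mode → ℂ) : FockFn
  | 1, 0, y, _ => f (y 0)
  | _, _, _, _ => 0

/-- The antisymmetric amplitude of a pair of fermions with opposite spins. -/
def pairAmp (F : Site × Site → ℂ) : Mode → Mode → ℂ
  | (x₀, Spin.down), (x₁, Spin.up) => F (x₁, x₀)
  | (x₀, Spin.up), (x₁, Spin.down) => -F (x₀, x₁)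
  | _, _ => 0

/-- The superposition of a pair of fermions of opposite spins and of a boson, with arbitrary wave
functions. -/
noncomputable def sectorFn (F : Site × Site → ℂ) (G : Site → ℂ) : FockFn
  | 2, 0, y, _ => (Real.sqrt 2 : ℂ)⁻¹ * pairAmp F (y 0) (y 1)
  | 0, 1, _, z => G (z 0)
  | _, _, _, _ => 0

/-- Passing to `sectorFn` allows arbitrary wave functions at intermediate stages, so that
square-summability is irrelevant until the final comparison. -/
theorem embed_eq_sectorFn (ψ : Sector) : embed ψ = sectorFn (pairPart ψ) (bosonPart ψ) := by
  funext m n y z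
  match m, n with
  | 0, 0 => rfl
  | 0, 1 => rfl
  | 0, n + 2 => rfl
  | 1, n => rfl
  | 2, 0 =>
    simp only [embed, sectorFn]
    rcases y 0 with ⟨x₀, _ | _⟩ <;> rcases y 1 with ⟨x₁, _ | _⟩ <;> simp [pairAmp]
  | 2, n + 1 => rfl
  | m + 3, n => rfl

theorem annF_sectorFn (a : Mode) (F : Site × Site → ℂ) (G : Site → ℂ) :
    annF a (sectorFn F G) = fermionFn (pairAmp F a) := by
  funext m n y z
  match m, n with
  | 0, n => simp [annF, sectorFn, fermionFn]
  | 1, 0 => simp [annF, sectorFn, fermionFn, one_add_one_eq_two]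
  | 1, n + 1 => simp [annF, sectorFn, fermionFn]
  | m + 2, n => simp [annF, sectorFn, fermionFn]

theorem annF_fermionFn (a : Mode) (f : Mode → ℂ) : annF a (fermionFn f) = vacuumFn (f a) := by
  funext m n y z
  match m, n with
  | 0, 0 => simp [annF, fermionFn, vacuumFn]
  | 0, n + 1 => simp [annF, fermionFn, vacuumFn]
  | m + 1, n => simp [annF, fermionFn, vacuumFn]

theorem creF_vacuumFn (a : Mode) (c : ℂ) :
    creF a (vacuumFn c) = fermionFn (fun b => if b = a then c else 0) := by
  funext m n y z
  match m, n with
  | 0, n => simp [creF, fermionFn]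
  | 1, 0 => simp [creF, fermionFn, vacuumFn]
  | 1, n + 1 => simp [creF, fermionFn, vacuumFn]
  | m + 2, n => simp [creF, fermionFn, vacuumFn]

theorem creF_fermionFn_apply (a : Mode) (f : Mode → ℂ) (y : Fin 2 → Mode) (z : Fin 0 → Site) :
    creF a (fermionFn f) 2 0 y z = (Real.sqrt 2 : ℂ)⁻¹ *
      ((if y 0 = a then f (y 1) else 0) - (if y 1 = a then f (y 0) else 0)) := by
  have h : creF a (fermionFn f) 2 0 y z = (Real.sqrt ((1 : ℕ) + 1) : ℂ)⁻¹ *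
      ∑ j : Fin 2, if y j = a then (-1 : ℂ) ^ (j : ℕ) * f (j.removeNth y 0) else 0 := rfl
  have h0 : Fin.removeNth 0 y 0 = y 1 := rfl
  have h1 : Fin.removeNth 1 y 0 = y 0 := rfl
  have h2 : Real.sqrt ((1 : ℕ) + 1) = Real.sqrt 2 := by norm_num
  rw [h, h2, Fin.sum_univ_two, h0, h1]
  congr 1
  split_ifs <;> simp [sub_eq_add_neg]

/-- The hypothesis on `f` excludes pairs of equal spin, which lie outside the sector. -/
theorem creF_down_fermionFn (x : Site) (f : Mode → ℂ) (hf : ∀ u, f (u, Spin.down) = 0) :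
    creF (x, Spin.down) (fermionFn f) =
      sectorFn (fun p => if p.2 = x then f (p.1, Spin.up) else 0) 0 := by
  funext m n y z
  match m, n with
  | 0, 0 => rfl
  | 0, 1 => rfl
  | 0, n + 2 => rfl
  | 1, n => simp [creF, fermionFn, sectorFn]
  | 2, 0 =>
    rw [creF_fermionFn_apply, sectorFn]
    rcases y 0 with ⟨x₀, _ | _⟩ <;> rcases y 1 with ⟨x₁, _ | _⟩ <;> simp [pairAmp, hf]
  | 2, n + 1 => simp [creF, fermionFn, sectorFn]
  | m + 3, n => simp [creF, fermionFn, sectorFn]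

theorem creF_up_fermionFn (x : Site) (f : Mode → ℂ) (hf : ∀ u, f (u, Spin.up) = 0) :
    creF (x, Spin.up) (fermionFn f) =
      sectorFn (fun p => if p.1 = x then -f (p.2, Spin.down) else 0) 0 := by
  funext m n y z
  match m, n with
  | 0, 0 => rfl
  | 0, 1 => rfl
  | 0, n + 2 => rfl
  | 1, n => simp [creF, fermionFn, sectorFn]
  | 2, 0 =>
    rw [creF_fermionFn_apply, sectorFn]
    rcases y 0 with ⟨x₀, _ | _⟩ <;> rcases y 1 with ⟨x₁, _ | _⟩ <;>
      simp [pairAmp, hf] <;> split_ifs <;> simp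
  | 2, n + 1 => simp [creF, fermionFn, sectorFn]
  | m + 3, n => simp [creF, fermionFn, sectorFn]

theorem annB_sectorFn (x : Site) (F : Site × Site → ℂ) (G : Site → ℂ) :
    annB x (sectorFn F G) = vacuumFn (G x) := by
  funext m n y z
  match m, n with
  | 0, 0 => simp [annB, sectorFn, vacuumFn]
  | 0, n + 1 => simp [annB, sectorFn, vacuumFn]
  | m + 1, n => simp [annB, sectorFn, vacuumFn]

theorem creB_vacuumFn (x : Site) (c : ℂ) :
    creB x (vacuumFn c) = sectorFn 0 (fun y => if y = x then c else 0) := by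
  have hp (a b : Mode) : pairAmp 0 a b = 0 := by
    rcases a with ⟨x₀, _ | _⟩ <;> rcases b with ⟨x₁, _ | _⟩ <;> simp [pairAmp]
  funext m n y z
  match m, n with
  | 0, 0 => rfl
  | 0, 1 => simp [creB, sectorFn, vacuumFn]
  | 0, n + 2 => simp [creB, sectorFn, vacuumFn]
  | 1, 0 => rfl
  | 1, n + 1 => simp [creB, sectorFn, vacuumFn]
  | 2, 0 => simp [creB, sectorFn, hp]
  | 2, n + 1 => simp [creB, sectorFn, vacuumFn]
  | m + 3, 0 => rfl
  | m + 3, n + 1 => simp [creB, sectorFn, vacuumFn]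

/-! ### Linearity -/

theorem pairAmp_map {ι : Type*} (L : (ι → ℂ) → ℂ) (hneg : ∀ f, L (fun i => -f i) = -L f)
    (hzero : L (fun _ => 0) = 0) (F : ι → Site × Site → ℂ) (a b : Mode) :
    pairAmp (fun p => L fun i => F i p) a b = L fun i => pairAmp (F i) a b := by
  rcases a with ⟨x₀, _ | _⟩ <;> rcases b with ⟨x₁, _ | _⟩ <;> simp [pairAmp, hneg, hzero]

/-- Each value of `sectorFn` is a fixed multiple of a single value of `F` or `G`, so homogeneity of
`L` is enough. This covers `tsum` without any summability, where additivity would fail. -/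
theorem sectorFn_map {ι : Type*} (L : (ι → ℂ) → ℂ) (hmul : ∀ (c : ℂ) f, L (fun i => c * f i) = c * L f)
    (F : ι → Site × Site → ℂ) (G : ι → Site → ℂ) :
    (fun m n y z => L fun i => sectorFn (F i) (G i) m n y z) =
      sectorFn (fun p => L fun i => F i p) (fun x => L fun i => G i x) := by
  have hneg (f : ι → ℂ) : L (fun i => -f i) = -L f := by simpa using hmul (-1) f
  have hzero : L (fun _ => 0) = 0 := by simpa using hmul 0 (fun _ => 0)
  funext m n y z
  match m, n with
  | 0, 0 => exact hzero
  | 0, 1 => rfl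
  | 0, n + 2 => exact hzero
  | 1, n => exact hzero
  | 2, 0 => simp only [sectorFn, pairAmp_map L hneg hzero, hmul]
  | 2, n + 1 => exact hzero
  | m + 3, n => exact hzero

theorem opSum_eq_sectorFn {ι : Type} {T : ι → FockFn → FockFn} {ψ : FockFn}
    {F : ι → Site × Site → ℂ} {G : ι → Site → ℂ} (h : ∀ i, T i ψ = sectorFn (F i) (G i)) :
    opSum T ψ = sectorFn (fun p => ∑' i, F i p) (fun x => ∑' i, G i x) := by
  rw [← sectorFn_map (fun f => ∑' i, f i) (fun c f => tsum_mul_left)]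
  funext m n y z
  simp only [opSum, h]

theorem sectorFn_add (F F' : Site × Site → ℂ) (G G' : Site → ℂ) :
    sectorFn F G + sectorFn F' G' = sectorFn (F + F') (G + G') := by
  have := sectorFn_map (ι := Bool) (fun f => f true + f false) (fun c f => by ring)
    (fun b => cond b F F') (fun b => cond b G G')
  exact this

theorem sectorFn_sub (F F' : Site × Site → ℂ) (G G' : Site → ℂ) :
    sectorFn F G - sectorFn F' G' = sectorFn (F - F') (G - G') := by
  have := sectorFn_map (ι := Bool) (fun f => f true - f false) (fun c f => by ring)
    (fun b => cond b F F') (fun b => cond b G G')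
  exact this

theorem sectorFn_neg (F : Site × Site → ℂ) (G : Site → ℂ) :
    -sectorFn F G = sectorFn (-F) (-G) :=
  sectorFn_map (ι := Unit) (fun f => -f ()) (fun c f => by ring) (fun _ => F) (fun _ => G)

theorem sectorFn_smul (r : ℝ) (F : Site × Site → ℂ) (G : Site → ℂ) :
    r • sectorFn F G = sectorFn (r • F) (r • G) :=
  sectorFn_map (ι := Unit) (fun f => r • f ()) (fun c f => by
    simp only [Complex.real_smul]; ring) (fun _ => F) (fun _ => G)

theorem sectorFn_sum {ι : Type*} (s : Finset ι) (F : ι → Site × Site → ℂ) (G : ι → Site → ℂ) :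
    ∑ i ∈ s, sectorFn (F i) (G i) = sectorFn (∑ i ∈ s, F i) (∑ i ∈ s, G i) := by
  have := sectorFn_map (fun f => ∑ i ∈ s, f i) (fun c f => (Finset.mul_sum _ _ _).symm) F G
  convert this using 1
  · funext m n y z; simp [Finset.sum_apply]
  · congr 1 <;> (funext p; simp [Finset.sum_apply])

theorem vacuumFn_sum_smul {ι : Type*} (s : Finset ι) (r : ι → ℝ) (c : ι → ℂ) :
    ∑ i ∈ s, r i • vacuumFn (c i) = vacuumFn (∑ i ∈ s, (r i : ℂ) * c i) := by
  funext m n y z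
  simp only [Finset.sum_apply, Pi.smul_apply, Complex.real_smul]
  match m, n with
  | 0, 0 => rfl
  | 0, n + 1 => simp [vacuumFn]
  | m + 1, n => simp [vacuumFn]

/-! ### Second-quantized operators on few-particle states -/

theorem hop_up_sectorFn (x y : Site) (F : Site × Site → ℂ) (G : Site → ℂ) :
    creF (x, Spin.up) (annF (y, Spin.up) (sectorFn F G)) =
      sectorFn (fun p => if p.1 = x then F (y, p.2) else 0) 0 := by
  rw [annF_sectorFn, creF_up_fermionFn _ _ (fun u => rfl)]
  simp [pairAmp]

theorem hop_down_sectorFn (x y : Site) (F : Site × Site → ℂ) (G : Site → ℂ) :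
    creF (x, Spin.down) (annF (y, Spin.down) (sectorFn F G)) =
      sectorFn (fun p => if p.2 = x then F (p.1, y) else 0) 0 := by
  rw [annF_sectorFn, creF_down_fermionFn _ _ (fun u => rfl)]
  simp [pairAmp]

theorem pairAnn_sectorFn (κ : ℝ) (x : Site) (F : Site × Site → ℂ) (G : Site → ℂ) :
    pairAnn κ x (sectorFn F G) =
      vacuumFn (∑ z ∈ unitBall, (Real.exp (-κ * siteNorm z) : ℂ) * F (x + z, x)) := by
  simp only [pairAnn, annF_sectorFn, annF_fermionFn, pairAmp, vacuumFn_sum_smul]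

theorem pairCre_vacuumFn (κ : ℝ) (x : Site) (c : ℂ) :
    pairCre κ x (vacuumFn c) =
      sectorFn (fun p => ∑ z ∈ unitBall, (Real.exp (-κ * siteNorm z) : ℂ) *
        (if p.2 = x then if p.1 = x + z then c else 0 else 0)) 0 := by
  have h (z : Site) : creF (x, Spin.down) (creF (x + z, Spin.up) (vacuumFn c)) =
      sectorFn (fun p => if p.2 = x then if p.1 = x + z then c else 0 else 0) 0 := by
    rw [creF_vacuumFn, creF_down_fermionFn _ _ (fun u => by simp)]
    simp
  simp only [pairCre, h, sectorFn_smul, sectorFn_sum]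
  congr 1
  funext p
  simp [Finset.sum_apply]

/-! ### Sums over sites and neighbours -/

/-- The nearest neighbours of the origin. -/
def neighbours : Finset Site := {(1, 0), (-1, 0), (0, 1), (0, -1)}

theorem siteNorm_zero : siteNorm (0 : Site) = 0 := by simp [siteNorm]

theorem mem_neighbours (e : Site) : e ∈ neighbours ↔ siteNorm e = 1 := by
  have h := mem_unitBall e
  constructor
  · intro he
    simp only [neighbours, Finset.mem_insert, Finset.mem_singleton] at he
    rcases he with rfl | rfl | rfl | rfl <;> simp [siteNorm]
  · intro he
    have h1 := h.2 he.le
    simp only [unitBall, Finset.mem_insert, Finset.mem_singleton] at h1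
    rcases h1 with rfl | h1
    · exact absurd he (by simp [siteNorm])
    · simpa [neighbours] using h1

theorem sum_unitBall {M : Type*} [AddCommMonoid M] (f : Site → M) :
    ∑ z ∈ unitBall, f z = f 0 + ∑ e ∈ neighbours, f e :=
  Finset.sum_insert (by decide)

/-- Only the four pairs `(u, u - e)` contribute, so the infinite sum is finite and no decay of `g`
is needed. -/
theorem hasSum_ite_nnpair (u : Site) (g : Site → ℂ) :
    HasSum (fun p : NNPair => if u = p.1.1 then g p.1.2 else 0) (∑ e ∈ neighbours, g (u - e)) := by
  let j : neighbours → NNPair := fun e =>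
    ⟨(u, u - e), by rw [sub_sub_cancel]; exact (mem_neighbours _).1 e.2⟩
  have hj : Function.Injective j := fun e e' h => by
    have : u - (e : Site) = u - (e' : Site) := congrArg (fun p : NNPair => p.1.2) h
    exact Subtype.ext (sub_right_injective this)
  rw [← hj.hasSum_iff]
  · have : (fun p : NNPair => if u = p.1.1 then g p.1.2 else 0) ∘ j =
        fun e : neighbours => g (u - e) := by
      funext e; simp [j]
    rw [this, ← Finset.sum_coe_sort]
    exact hasSum_fintype _
  · intro p hp
    rw [if_neg]
    rintro rfl
    refine hp ⟨⟨p.1.1 - p.1.2, (mem_neighbours _).2 p.2⟩, ?_⟩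
    simp [j]

theorem hasSum_spin_prod {ι : Type*} {f : Spin × ι → ℂ} {a b : ℂ}
    (ha : HasSum (fun i => f (Spin.up, i)) a) (hb : HasSum (fun i => f (Spin.down, i)) b) :
    HasSum f (a + b) := by
  have h1 (s : Spin) {c : ℂ} (hc : HasSum (fun i => f (s, i)) c) :
      HasSum (fun p : Spin × ι => if p.1 = s then f p else 0) c := by
    rw [← (Prod.mk_right_injective s).hasSum_iff]
    · simpa [Function.comp_def] using hc
    · rintro ⟨t, i⟩ hp
      rw [if_neg]
      rintro rfl
      exact hp ⟨i, rfl⟩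
  convert (h1 _ ha).add (h1 _ hb) using 1
  funext p
  rcases p with ⟨_ | _, i⟩ <;> simp

theorem tsum_ite_fst (u : Site) (g : Site × Site → ℂ) :
    ∑' p : Site × Site, (if u = p.1 then g p else 0) = ∑' y, g (u, y) := by
  rw [← (Prod.mk_right_injective u).tsum_eq]
  · simp
  · rintro ⟨x, y⟩ hp
    have : u = x := by
      by_contra hne
      simp [hne] at hp
    subst this
    exact ⟨y, rfl⟩

end Fock

/-! ### Channels and kinetic energies on the sector. -/

section Restriction

open ContinuousLinearMap

/-! ### The components of the sector -/

/-- The projection onto the pair component. -/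
noncomputable def pairL : Sector →L[ℂ] ℓ²(Site × Site, ℂ) :=
  WithLp.fstL 2 ℂ (ℓ²(Site × Site, ℂ)) (ℓ²(Site, ℂ))

/-- The projection onto the boson component. -/
noncomputable def bosonL : Sector →L[ℂ] ℓ²(Site, ℂ) :=
  WithLp.sndL 2 ℂ (ℓ²(Site × Site, ℂ)) (ℓ²(Site, ℂ))

theorem pairL_apply (ψ : Sector) : pairL ψ = pairPart ψ := rfl

theorem bosonL_apply (ψ : Sector) : bosonL ψ = bosonPart ψ := rfl

/-- The vector of the sector with the given components. -/
noncomputable def sectorMk (F : ℓ²(Site × Site, ℂ)) (G : ℓ²(Site, ℂ)) : Sector :=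
  WithLp.toLp 2 (F, G)

theorem sector_inner (ψ φ : Sector) :
    inner ℂ ψ φ = inner ℂ (pairPart ψ) (pairPart φ) + inner ℂ (bosonPart ψ) (bosonPart φ) := rfl

theorem adjoint_pairL_apply (F : ℓ²(Site × Site, ℂ)) : adjoint pairL F = sectorMk F 0 := by
  refine ext_inner_right ℂ fun φ => ?_
  rw [adjoint_inner_left, sector_inner]
  change _ = inner ℂ F (pairPart φ) + inner ℂ (0 : ℓ²(Site, ℂ)) (bosonPart φ)
  rw [inner_zero_left, add_zero]
  rfl

theorem adjoint_bosonL_apply (G : ℓ²(Site, ℂ)) : adjoint bosonL G = sectorMk 0 G := by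
  refine ext_inner_right ℂ fun φ => ?_
  rw [adjoint_inner_left, sector_inner]
  change _ = inner ℂ (0 : ℓ²(Site × Site, ℂ)) (pairPart φ) + inner ℂ G (bosonPart φ)
  rw [inner_zero_left, zero_add]
  rfl

theorem pairL_comp_adjoint : pairL ∘L adjoint pairL = 1 := by
  refine ContinuousLinearMap.ext fun F => ?_
  rw [comp_apply, adjoint_pairL_apply]
  rfl

theorem bosonL_comp_adjoint : bosonL ∘L adjoint bosonL = 1 := by
  refine ContinuousLinearMap.ext fun F => ?_
  rw [comp_apply, adjoint_bosonL_apply]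
  rfl

theorem pairL_comp_adjoint_bosonL : pairL ∘L adjoint bosonL = 0 := by
  refine ContinuousLinearMap.ext fun F => ?_
  rw [comp_apply, adjoint_bosonL_apply]
  rfl

theorem pairL_adjoint_pairL (F : ℓ²(Site × Site, ℂ)) : pairL (adjoint pairL F) = F :=
  DFunLike.congr_fun pairL_comp_adjoint F

theorem bosonL_adjoint_bosonL (G : ℓ²(Site, ℂ)) : bosonL (adjoint bosonL G) = G :=
  DFunLike.congr_fun bosonL_comp_adjoint G

theorem pairL_adjoint_bosonL (G : ℓ²(Site, ℂ)) : pairL (adjoint bosonL G) = 0 :=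
  DFunLike.congr_fun pairL_comp_adjoint_bosonL G

theorem bosonL_adjoint_pairL (F : ℓ²(Site × Site, ℂ)) : bosonL (adjoint pairL F) = 0 := by
  rw [adjoint_pairL_apply]
  rfl

instance : Nontrivial Sector := by
  refine ⟨⟨adjoint bosonL (lp.single 2 0 1), 0, fun h => ?_⟩⟩
  have h1 := congrArg bosonL h
  rw [bosonL_adjoint_bosonL, map_zero] at h1
  have h2 := congrArg (fun f : ℓ²(Site, ℂ) => f 0) h1
  simp at h2

/-! ### Pair channels -/

theorem relative_injective (z : Site) : Function.Injective fun x : Site => (x + z, x) :=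
  fun _ _ h => (Prod.ext_iff.1 h).2

/-- The wave function of the centre of pairs with separation `z`. -/
noncomputable def relativeL (z : Site) : ℓ²(Site × Site, ℂ) →L[ℂ] ℓ²(Site, ℂ) :=
  pull (fun x : Site => (x + z, x)) (relative_injective z)

@[simp]
theorem relativeL_apply (z x : Site) (F : ℓ²(Site × Site, ℂ)) :
    relativeL z F x = F (x + z, x) := rfl

theorem relativeL_comp_adjoint_self (z : Site) : relativeL z ∘L adjoint (relativeL z) = 1 :=
  pull_comp_adjoint_self _ _

theorem relativeL_comp_adjoint_of_ne {z z' : Site} (h : z ≠ z') :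
    relativeL z ∘L adjoint (relativeL z') = 0 := by
  refine pull_comp_adjoint_of_disjoint _ _ fun a d hd => h ?_
  obtain ⟨h1, h2⟩ := Prod.ext_iff.1 hd
  simp only at h1 h2
  subst h2
  exact (add_left_cancel h1).symm

theorem adjoint_relativeL_apply (z : Site) (g : ℓ²(Site, ℂ)) (p : Site × Site) :
    adjoint (relativeL z) g p = if p.1 = p.2 + z then g p.2 else 0 := by
  obtain ⟨u, d⟩ := p
  split_ifs with h
  · have h' : u = d + z := h
    subst h'
    exact adjoint_pull_apply (fun x : Site => (x + z, x)) (relative_injective z) g d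
  · refine adjoint_pull_apply_of_forall_ne _ (relative_injective z) g fun a ha => h ?_
    obtain ⟨h1, h2⟩ := Prod.ext_iff.1 ha
    simp only at h1 h2
    subst h2
    exact h1.symm

/-- The normalized channel of pairs on neighbouring sites. -/
noncomputable def neighbourL : ℓ²(Site × Site, ℂ) →L[ℂ] ℓ²(Site, ℂ) :=
  ((1 / 2 : ℝ) : ℂ) • ∑ e ∈ neighbours, relativeL e

theorem adjoint_neighbourL : adjoint neighbourL =
    ((1 / 2 : ℝ) : ℂ) • ∑ e ∈ neighbours, adjoint (relativeL e) := by
  rw [neighbourL, map_smulₛₗ, map_sum, Complex.conj_ofReal]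

/-- The four separations have orthogonal ranges, so the sum contributes 4, cancelled by the square
of the normalization `1 / 2`. -/
theorem neighbourL_comp_adjoint_self : neighbourL ∘L adjoint neighbourL = 1 := by
  rw [adjoint_neighbourL, neighbourL]
  simp only [smul_comp, comp_smul, finsetSum_comp, comp_finsetSum]
  have h (e : Site) (he : e ∈ neighbours) :
      ∑ e' ∈ neighbours, relativeL e' ∘L adjoint (relativeL e) = 1 := by
    rw [Finset.sum_eq_single_of_mem e he fun e' _ hne => relativeL_comp_adjoint_of_ne hne]
    exact relativeL_comp_adjoint_self e
  rw [← Finset.smul_sum, Finset.sum_congr rfl h, Finset.sum_const, smul_smul]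
  have hc : neighbours.card = 4 := rfl
  rw [hc, ← Nat.cast_smul_eq_nsmul ℂ, smul_smul]
  norm_num

theorem relativeL_zero_comp_adjoint_neighbourL : relativeL 0 ∘L adjoint neighbourL = 0 := by
  rw [adjoint_neighbourL]
  simp only [comp_smul, comp_finsetSum]
  rw [Finset.sum_eq_zero, smul_zero]
  intro e he
  refine relativeL_comp_adjoint_of_ne ?_
  rintro rfl
  exact absurd he (by decide)

/-- The channel of doubly occupied sites. -/
noncomputable def onsiteChannel : Sector →L[ℂ] ℓ²(Site, ℂ) := relativeL 0 ∘L pairL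

/-- The channel of pairs on neighbouring sites. -/
noncomputable def neighbourChannel : Sector →L[ℂ] ℓ²(Site, ℂ) := neighbourL ∘L pairL

theorem isChannelTriple : IsChannelTriple onsiteChannel neighbourChannel bosonL where
  PP := by
    refine ContinuousLinearMap.ext fun g => ?_
    simp only [onsiteChannel, adjoint_comp, comp_apply, pairL_adjoint_pairL]
    exact DFunLike.congr_fun (relativeL_comp_adjoint_self 0) g
  DD := by
    refine ContinuousLinearMap.ext fun g => ?_
    simp only [neighbourChannel, adjoint_comp, comp_apply, pairL_adjoint_pairL]
    exact DFunLike.congr_fun neighbourL_comp_adjoint_self g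
  BB := bosonL_comp_adjoint
  PD := by
    refine ContinuousLinearMap.ext fun g => ?_
    simp only [onsiteChannel, neighbourChannel, adjoint_comp, comp_apply, pairL_adjoint_pairL]
    exact DFunLike.congr_fun relativeL_zero_comp_adjoint_neighbourL g
  PB := by
    refine ContinuousLinearMap.ext fun g => ?_
    simp only [onsiteChannel, comp_apply, pairL_adjoint_bosonL, map_zero]
    rfl
  DB := by
    refine ContinuousLinearMap.ext fun g => ?_
    simp only [neighbourChannel, comp_apply, pairL_adjoint_bosonL, map_zero]
    rfl

/-- The pair annihilation operator on pair wave functions. -/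
noncomputable def pairFormL (κ : ℝ) : ℓ²(Site × Site, ℂ) →L[ℂ] ℓ²(Site, ℂ) :=
  ∑ z ∈ unitBall, (Real.exp (-κ * siteNorm z) : ℂ) • relativeL z

theorem pairFormL_apply (κ : ℝ) (F : ℓ²(Site × Site, ℂ)) (x : Site) :
    pairFormL κ F x = ∑ z ∈ unitBall, (Real.exp (-κ * siteNorm z) : ℂ) * F (x + z, x) := by
  simp only [pairFormL, sum_apply, smul_apply]
  rw [lp.coeFn_sum, Finset.sum_apply]
  rfl

theorem adjoint_pairFormL_apply (κ : ℝ) (g : ℓ²(Site, ℂ)) (p : Site × Site) :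
    adjoint (pairFormL κ) g p = ∑ z ∈ unitBall, (Real.exp (-κ * siteNorm z) : ℂ) *
      (if p.1 = p.2 + z then g p.2 else 0) := by
  have h : adjoint (pairFormL κ) = ∑ z ∈ unitBall,
      (Real.exp (-κ * siteNorm z) : ℂ) • adjoint (relativeL z) := by
    rw [pairFormL, map_sum]
    refine Finset.sum_congr rfl fun z _ => ?_
    rw [map_smulₛₗ, Complex.conj_ofReal]
  rw [h]
  simp only [sum_apply, smul_apply, ← adjoint_relativeL_apply]
  rw [lp.coeFn_sum, Finset.sum_apply]
  rfl

/-- This is the origin of `γ = 2 exp(-κ)`: each of the four neighbours has weight `exp(-κ)`, and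
their sum is twice the normalized channel. -/
theorem pairChannel_eq (κ : ℝ) :
    pairChannel onsiteChannel neighbourChannel (2 * Real.exp (-κ)) = pairFormL κ ∘L pairL := by
  rw [pairChannel, onsiteChannel, neighbourChannel, pairFormL, sum_unitBall, siteNorm_zero,
    neighbourL]
  have h : ∑ e ∈ neighbours, (Real.exp (-κ * siteNorm e) : ℂ) • relativeL e =
      ∑ e ∈ neighbours, (Real.exp (-κ) : ℂ) • relativeL e :=
    Finset.sum_congr rfl fun e he => by rw [(mem_neighbours e).1 he, mul_one]
  rw [h, ← Finset.smul_sum, add_comp, smul_comp, smul_comp, smul_comp, smul_smul]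
  congr 1
  · simp
  · congr 1
    push_cast
    ring

/-! ### Kinetic energies -/

theorem isSelfAdjoint_sum_shift {G : Type*} [AddCommGroup G] (i : Site →+ G) :
    IsSelfAdjoint (∑ e ∈ neighbours, shift (i e)) := by
  rw [isSelfAdjoint_iff, star_sum]
  simp only [star_shift, ← map_neg]
  refine Finset.sum_nbij' (fun e => -e) (fun e => -e) (by decide) (by decide) ?_ ?_ ?_ <;> simp

/-- The hopping of a boson. -/
noncomputable def bosonHopping : ℓ²(Site, ℂ) →L[ℂ] ℓ²(Site, ℂ) :=
  ∑ e ∈ neighbours, shift ((AddMonoidHom.id Site) e)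

/-- The hopping of a pair of fermions. -/
noncomputable def pairHopping : ℓ²(Site × Site, ℂ) →L[ℂ] ℓ²(Site × Site, ℂ) :=
  ∑ e ∈ neighbours, shift ((AddMonoidHom.inl Site Site) e) +
    ∑ e ∈ neighbours, shift ((AddMonoidHom.inr Site Site) e)

theorem bosonHopping_apply (G : ℓ²(Site, ℂ)) (x : Site) :
    bosonHopping G x = ∑ e ∈ neighbours, G (x - e) := by
  simp only [bosonHopping, sum_apply]
  rw [lp.coeFn_sum, Finset.sum_apply]
  rfl

theorem pairHopping_apply (F : ℓ²(Site × Site, ℂ)) (p : Site × Site) :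
    pairHopping F p = ∑ e ∈ neighbours, F (p.1 - e, p.2) + ∑ e ∈ neighbours, F (p.1, p.2 - e) := by
  simp only [pairHopping, add_apply, sum_apply]
  rw [lp.coeFn_add, Pi.add_apply, lp.coeFn_sum, lp.coeFn_sum, Finset.sum_apply, Finset.sum_apply]
  simp [Prod.sub_def]

/-- The kinetic energy of a pair of fermions. -/
noncomputable def pairKinetic : ℓ²(Site × Site, ℂ) →L[ℂ] ℓ²(Site × Site, ℂ) :=
  ((-(1 / 2) : ℝ) : ℂ) • pairHopping + ((4 : ℝ) : ℂ) • 1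

/-- The kinetic energy of a boson. -/
noncomputable def bosonKinetic (hb : ℝ) : ℓ²(Site, ℂ) →L[ℂ] ℓ²(Site, ℂ) :=
  ((-(hb / 2) : ℝ) : ℂ) • bosonHopping + ((2 * hb : ℝ) : ℂ) • 1

theorem isSelfAdjoint_pairKinetic : IsSelfAdjoint pairKinetic :=
  (isSelfAdjoint_real_smul _ ((isSelfAdjoint_sum_shift _).add (isSelfAdjoint_sum_shift _))).add
    (isSelfAdjoint_real_smul _ (.one _))

theorem isSelfAdjoint_bosonKinetic (hb : ℝ) : IsSelfAdjoint (bosonKinetic hb) :=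
  (isSelfAdjoint_real_smul _ (isSelfAdjoint_sum_shift _)).add (isSelfAdjoint_real_smul _ (.one _))

/-- The kinetic energy on the sector. -/
noncomputable def sectorKinetic (hb : ℝ) : Sector →L[ℂ] Sector :=
  adjoint pairL ∘L pairKinetic ∘L pairL + adjoint bosonL ∘L bosonKinetic hb ∘L bosonL

theorem isSelfAdjoint_sectorKinetic (hb : ℝ) : IsSelfAdjoint (sectorKinetic hb) :=
  (isSelfAdjoint_adjoint_comp_comp isSelfAdjoint_pairKinetic).add
    (isSelfAdjoint_adjoint_comp_comp (isSelfAdjoint_bosonKinetic hb))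

/-- The kinetic energy of the fermions on the sector. -/
noncomputable def sectorPairKinetic : Sector →L[ℂ] Sector :=
  adjoint pairL ∘L pairKinetic ∘L pairL

theorem isSelfAdjoint_sectorPairKinetic : IsSelfAdjoint sectorPairKinetic :=
  isSelfAdjoint_adjoint_comp_comp isSelfAdjoint_pairKinetic

end Restriction

/-! ### Identification of the Fock space Hamiltonians with the abstract models. -/

section Restriction

open ContinuousLinearMap

/-! ### The Fock space Hamiltonians on the sector -/

/-- A function on the spin states. -/
def bySpin (a b : ℂ) : Spin → ℂ
  | Spin.up => a
  | Spin.down => b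

theorem tsum_bySpin {ι : Type*} {f g : ι → ℂ} {a b : ℂ} (hf : HasSum f a) (hg : HasSum g b) :
    ∑' i : Spin × ι, bySpin (f i.2) (g i.2) i.1 = a + b :=
  (hasSum_spin_prod (f := fun i : Spin × ι => bySpin (f i.2) (g i.2) i.1) hf hg).tsum_eq

theorem opSum_hopping (F : Site × Site → ℂ) (G : Site → ℂ) :
    opSum (fun i : Spin × NNPair => fun φ => creF (i.2.1.1, i.1) (annF (i.2.1.2, i.1) φ))
        (sectorFn F G) =
      sectorFn (fun p => ∑ e ∈ neighbours, F (p.1 - e, p.2) + ∑ e ∈ neighbours, F (p.1, p.2 - e))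
        0 := by
  rw [opSum_eq_sectorFn (F := fun i p => bySpin (if p.1 = i.2.1.1 then F (i.2.1.2, p.2) else 0)
    (if p.2 = i.2.1.1 then F (p.1, i.2.1.2) else 0) i.1) (G := fun _ => 0)]
  · congr 1
    · funext p
      exact tsum_bySpin (f := fun q : NNPair => if p.1 = q.1.1 then F (q.1.2, p.2) else 0)
        (g := fun q : NNPair => if p.2 = q.1.1 then F (p.1, q.1.2) else 0)
        (hasSum_ite_nnpair p.1 fun x => F (x, p.2)) (hasSum_ite_nnpair p.2 fun x => F (p.1, x))
    · funext x
      exact tsum_zero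
  · rintro ⟨_ | _, p⟩
    · exact hop_up_sectorFn _ _ F G
    · exact hop_down_sectorFn _ _ F G

theorem tsum_ite_eq_left (u : Site) (g : Site → ℂ) : ∑' x, (if u = x then g x else 0) = g u := by
  simp only [eq_comm (a := u)]
  exact tsum_ite_eq u g

theorem hasSum_ite_eq_left (u : Site) (g : Site → ℂ) :
    HasSum (fun x => if u = x then g x else 0) (g u) := by
  have := hasSum_single (f := fun x => if u = x then g x else 0) u
    (fun x hx => if_neg (Ne.symm hx))
  simpa using this

theorem opSum_number (F : Site × Site → ℂ) (G : Site → ℂ) :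
    opSum (fun i : Spin × Site => numF (i.2, i.1)) (sectorFn F G) =
      sectorFn (fun p => F p + F p) 0 := by
  rw [opSum_eq_sectorFn (F := fun i p => bySpin (if p.1 = i.2 then F (i.2, p.2) else 0)
    (if p.2 = i.2 then F (p.1, i.2) else 0) i.1) (G := fun _ => 0)]
  · congr 1
    · funext p
      exact tsum_bySpin (f := fun q : Site => if p.1 = q then F (q, p.2) else 0)
        (g := fun q : Site => if p.2 = q then F (p.1, q) else 0)
        (hasSum_ite_eq_left p.1 fun x => F (x, p.2)) (hasSum_ite_eq_left p.2 fun x => F (p.1, x))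
    · funext x
      exact tsum_zero
  · rintro ⟨_ | _, p⟩
    · exact hop_up_sectorFn _ _ F G
    · exact hop_down_sectorFn _ _ F G

theorem opSum_onsite (F : Site × Site → ℂ) (G : Site → ℂ) :
    opSum (fun x : Site => fun φ => numF (x, Spin.up) (numF (x, Spin.down) φ)) (sectorFn F G) =
      sectorFn (fun p => if p.1 = p.2 then F p else 0) 0 := by
  rw [opSum_eq_sectorFn (F := fun x p => if p.1 = x then if p.2 = x then F (x, x) else 0 else 0)
    (G := fun _ => 0)]
  · congr 1
    · funext p
      rw [tsum_ite_eq_left p.1 fun x => if p.2 = x then F (x, x) else 0]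
      obtain ⟨u, d⟩ := p
      by_cases h : u = d
      · subst h; simp
      · simp [h, Ne.symm h]
    · funext x
      exact tsum_zero
  · intro x
    simp only [numF]
    rw [hop_down_sectorFn, hop_up_sectorFn]

theorem fermionH_sectorFn (hop U : ℝ) (F : Site × Site → ℂ) (G : Site → ℂ) :
    fermionH hop U (sectorFn F G) = sectorFn
      (fun p => hop * (((-(1 / 2) : ℝ) : ℂ) * (∑ e ∈ neighbours, F (p.1 - e, p.2) +
        ∑ e ∈ neighbours, F (p.1, p.2 - e)) + 4 * F p) + U * (if p.1 = p.2 then F p else 0)) 0 := by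
  rw [fermionH, opSum_hopping, opSum_number, opSum_onsite]
  simp only [sectorFn_smul, sectorFn_add]
  congr 1
  · funext p
    simp only [Pi.add_apply, Pi.smul_apply, Complex.real_smul]
    push_cast
    ring
  · simp

theorem opSum_creB_annB {ι : Type} (q : ι → Site × Site) (r : ι → ℝ) (F : Site × Site → ℂ)
    (G : Site → ℂ) :
    opSum (fun i => fun φ => r i • creB (q i).1 (annB (q i).2 φ)) (sectorFn F G) =
      sectorFn 0 (fun y => ∑' i, if y = (q i).1 then (r i : ℂ) * G (q i).2 else 0) := by
  rw [opSum_eq_sectorFn (F := fun _ => 0)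
    (G := fun i y => if y = (q i).1 then (r i : ℂ) * G (q i).2 else 0)]
  · congr 1
    funext p
    exact tsum_zero
  · intro i
    rw [annB_sectorFn, creB_vacuumFn, sectorFn_smul, smul_zero]
    congr 1
    funext y
    simp

theorem bosonH_sectorFn (hop hb : ℝ) (F : Site × Site → ℂ) (G : Site → ℂ) :
    bosonH hop hb (sectorFn F G) = sectorFn 0
      (fun x => hop * (((-(hb / 2) : ℝ) : ℂ) * (∑ e ∈ neighbours, G (x - e))
        + ((2 * hb : ℝ) : ℂ) * G x)) := by
  have h1 := opSum_creB_annB (fun p : NNPair => p.1) (fun _ => 1) F G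
  have h2 := opSum_creB_annB (fun x : Site => (x, x)) (fun _ => 1) F G
  simp only [one_smul, Complex.ofReal_one, one_mul] at h1 h2
  rw [bosonH, h1, h2]
  simp only [sectorFn_smul, sectorFn_add]
  congr 1
  · simp
  · funext x
    simp only [Pi.add_apply, Pi.smul_apply, Complex.real_smul]
    rw [(hasSum_ite_nnpair x G).tsum_eq, tsum_ite_eq_left x G]

theorem effBosonH_sectorFn (w : Site → ℝ) (F : Site × Site → ℂ) (G : Site → ℂ) :
    effBosonH w (sectorFn F G) = sectorFn 0 (fun x => -∑' y, (w (x - y) : ℂ) * G y) := by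
  rw [effBosonH, opSum_creB_annB (fun p => p) (fun p => w (p.1 - p.2)), sectorFn_neg, neg_zero]
  congr 1
  funext x
  rw [Pi.neg_apply, tsum_ite_fst x fun p => (w (p.1 - p.2) : ℂ) * G p.2]

/-- The created spin-down fermion fixes the first summation variable, and the finite sum over
separations factors out of what remains. No summability is required, since `tsum_mul_left` over `ℂ`
holds unconditionally. -/
theorem tsum_pairCre (κ : ℝ) (a : Site × Site → ℝ) (c : Site × Site → ℂ) (p : Site × Site) :
    ∑' q : Site × Site, (a q : ℂ) * ∑ z ∈ unitBall, (Real.exp (-κ * siteNorm z) : ℂ) *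
        (if p.2 = q.1 then if p.1 = q.1 + z then c q else 0 else 0) =
      ∑ z ∈ unitBall, (Real.exp (-κ * siteNorm z) : ℂ) *
        (if p.1 = p.2 + z then ∑' y, (a (p.2, y) : ℂ) * c (p.2, y) else 0) := by
  have h (q : Site × Site) : (a q : ℂ) * ∑ z ∈ unitBall, (Real.exp (-κ * siteNorm z) : ℂ) *
        (if p.2 = q.1 then if p.1 = q.1 + z then c q else 0 else 0) =
      if p.2 = q.1 then (∑ z ∈ unitBall, (Real.exp (-κ * siteNorm z) : ℂ) *
        (if p.1 = p.2 + z then 1 else 0)) * ((a q : ℂ) * c q) else 0 := by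
    by_cases hq : p.2 = q.1
    · simp only [← hq, if_true, Finset.sum_mul, Finset.mul_sum]
      refine Finset.sum_congr rfl fun z _ => ?_
      split_ifs <;> ring
    · simp [hq]
  simp only [h]
  rw [tsum_ite_fst p.2 fun q => (∑ z ∈ unitBall, (Real.exp (-κ * siteNorm z) : ℂ) *
        (if p.1 = p.2 + z then 1 else 0)) * ((a q : ℂ) * c q), tsum_mul_left, Finset.sum_mul]
  refine Finset.sum_congr rfl fun z _ => ?_
  split_ifs <;> ring

theorem effFermionH_sectorFn (hop U κ : ℝ) (w : Site → ℝ) (F : Site × Site → ℂ) (G : Site → ℂ) :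
    effFermionH hop U κ w (sectorFn F G) = fermionH hop U (sectorFn F G) -
      sectorFn (fun p => ∑ z ∈ unitBall, (Real.exp (-κ * siteNorm z) : ℂ) *
        (if p.1 = p.2 + z then ∑' y, (w (p.2 - y) : ℂ) *
          ∑ z' ∈ unitBall, (Real.exp (-κ * siteNorm z') : ℂ) * F (y + z', y) else 0)) 0 := by
  rw [effFermionH, opSum_eq_sectorFn (F := fun q p => (w (q.1 - q.2) : ℂ) *
    ∑ z ∈ unitBall, (Real.exp (-κ * siteNorm z) : ℂ) * (if p.2 = q.1 then if p.1 = q.1 + z then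
      ∑ z' ∈ unitBall, (Real.exp (-κ * siteNorm z') : ℂ) * F (q.2 + z', q.2) else 0 else 0))
    (G := fun _ => 0)]
  · congr 2
    · funext p
      exact tsum_pairCre κ (fun q => w (q.1 - q.2)) (fun q =>
        ∑ z' ∈ unitBall, (Real.exp (-κ * siteNorm z') : ℂ) * F (q.2 + z', q.2)) p
    · funext x
      exact tsum_zero
  · intro q
    rw [pairAnn_sectorFn, pairCre_vacuumFn, sectorFn_smul, smul_zero]
    congr 1

/-- Evenness of `v` makes the pair-creating half a convolution by `v` rather than by its reflection,
so both halves involve the same operator. -/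
theorem exchangeW_sectorFn (κ : ℝ) (v : Site → ℝ) (hv : ∀ x, v (-x) = v x) (F : Site × Site → ℂ)
    (G : Site → ℂ) :
    exchangeW κ v (sectorFn F G) =
      sectorFn (fun p => ∑ z ∈ unitBall, (Real.exp (-κ * siteNorm z) : ℂ) *
          (if p.1 = p.2 + z then ∑' y, (v (p.2 - y) : ℂ) * G y else 0))
        (fun x => ∑' y, (v (x - y) : ℂ) *
          ∑ z ∈ unitBall, (Real.exp (-κ * siteNorm z) : ℂ) * F (y + z, y)) := by
  rw [exchangeW, opSum_eq_sectorFn (F := fun q p => (v (q.1 - q.2) : ℂ) *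
    ∑ z ∈ unitBall, (Real.exp (-κ * siteNorm z) : ℂ) * (if p.2 = q.2 then if p.1 = q.2 + z then
      G q.1 else 0 else 0))
    (G := fun q x => if x = q.1 then (v (q.1 - q.2) : ℂ) *
      ∑ z ∈ unitBall, (Real.exp (-κ * siteNorm z) : ℂ) * F (q.2 + z, q.2) else 0)]
  · congr 1
    · funext p
      have h := tsum_pairCre κ (fun q => v (q.1 - q.2)) (fun q => G q.2) p
      rw [← h, ← (Equiv.prodComm Site Site).tsum_eq]
      refine tsum_congr fun q => ?_
      simp only [Equiv.prodComm_apply, Prod.fst_swap, Prod.snd_swap]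
      rw [← neg_sub, hv]
      rfl
    · funext x
      exact tsum_ite_fst x fun q => (v (q.1 - q.2) : ℂ) *
        ∑ z ∈ unitBall, (Real.exp (-κ * siteNorm z) : ℂ) * F (q.2 + z, q.2)
  · intro q
    rw [pairAnn_sectorFn, creB_vacuumFn, annB_sectorFn, pairCre_vacuumFn, sectorFn_add,
      sectorFn_smul]
    congr 1
    · funext p
      simp only [Pi.smul_apply, Complex.real_smul, zero_add]
    · funext x
      simp only [Pi.smul_apply, Complex.real_smul, add_zero]
      split_ifs <;> simp

/-! ### The restrictions to the sector -/

theorem pairKinetic_apply (F : ℓ²(Site × Site, ℂ)) (p : Site × Site) :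
    pairKinetic F p = ((-(1 / 2) : ℝ) : ℂ) * (∑ e ∈ neighbours, F (p.1 - e, p.2) +
        ∑ e ∈ neighbours, F (p.1, p.2 - e)) + 4 * F p := by
  rw [← pairHopping_apply, pairKinetic, add_apply, smul_apply, smul_apply, one_apply_eq_self,
    lp.coeFn_add, lp.coeFn_smul, lp.coeFn_smul]
  simp

theorem bosonKinetic_apply (hb : ℝ) (G : ℓ²(Site, ℂ)) (x : Site) :
    bosonKinetic hb G x = ((-(hb / 2) : ℝ) : ℂ) * (∑ e ∈ neighbours, G (x - e))
        + ((2 * hb : ℝ) : ℂ) * G x := by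
  rw [← bosonHopping_apply, bosonKinetic, add_apply, smul_apply, smul_apply, one_apply_eq_self,
    lp.coeFn_add, lp.coeFn_smul, lp.coeFn_smul]
  simp

theorem adjoint_onsite_apply (F : ℓ²(Site × Site, ℂ)) (p : Site × Site) :
    adjoint (relativeL 0) (relativeL 0 F) p = if p.1 = p.2 then F p else 0 := by
  obtain ⟨u, d⟩ := p
  rw [adjoint_relativeL_apply, add_zero]
  by_cases h : u = d
  · subst h; simp
  · simp [h]

theorem convOp_smul (c : ℝ) (v : Site → ℝ) : convOp (c • v) = (c : ℂ) • convOp v :=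
  repSum_smul c v

theorem isSectorRestriction_fullH {v : Site → ℝ} (hv : Summable v) (hsymm : ∀ x, v (-x) = v x)
    (hop U hb κ : ℝ) :
    IsSectorRestriction (fullH hop U hb κ v)
      (coupledModel onsiteChannel neighbourChannel bosonL (convOp v) (sectorKinetic hb)
        (2 * Real.exp (-κ)) hop U) := by
  intro ψ
  set T := coupledModel onsiteChannel neighbourChannel bosonL (convOp v) (sectorKinetic hb)
        (2 * Real.exp (-κ)) hop U with hT
  have hpair : pairPart (T ψ) = (U : ℂ) • adjoint (relativeL 0) (relativeL 0 (pairPart ψ))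
      + adjoint (pairFormL κ) (convOp v (bosonPart ψ)) + (hop : ℂ) • pairKinetic (pairPart ψ) := by
    rw [← pairL_apply, ← pairL_apply, ← bosonL_apply, hT, coupledModel, pairChannel_eq]
    simp only [onsiteChannel, sectorKinetic, adjoint_comp, add_apply, smul_apply, comp_apply,
      map_add, map_smul, pairL_adjoint_pairL, pairL_adjoint_bosonL, add_zero]
  have hboson : bosonPart (T ψ) = convOp v (pairFormL κ (pairPart ψ))
      + (hop : ℂ) • bosonKinetic hb (bosonPart ψ) := by
    rw [← bosonL_apply, ← pairL_apply, ← bosonL_apply, hT, coupledModel, pairChannel_eq]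
    simp only [onsiteChannel, sectorKinetic, adjoint_comp, add_apply, smul_apply, comp_apply,
      map_add, map_smul, bosonL_adjoint_pairL, bosonL_adjoint_bosonL, smul_zero, zero_add]
  rw [embed_eq_sectorFn, embed_eq_sectorFn, fullH, fermionH_sectorFn, bosonH_sectorFn,
    exchangeW_sectorFn κ v hsymm, sectorFn_add, sectorFn_add, hpair, hboson]
  congr 1
  · funext p
    simp only [lp.coeFn_add, lp.coeFn_smul, Pi.add_apply, Pi.smul_apply, smul_eq_mul,
      adjoint_pairFormL_apply, convOp_apply hv, pairKinetic_apply, adjoint_onsite_apply,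
      add_zero]
    ring
  · funext x
    simp only [lp.coeFn_add, lp.coeFn_smul, Pi.add_apply, Pi.smul_apply, smul_eq_mul,
      convOp_apply hv, pairFormL_apply, bosonKinetic_apply, zero_add]
    ring

theorem isSectorRestriction_uncoupledH {vp vm : Site → ℝ} {γb γf U κ : ℝ}
    (hf : Summable (kernelF γf U vp vm)) (hb : Summable (kernelB γb U vp vm)) (hop : ℝ) :
    IsSectorRestriction (uncoupledH hop U κ γb γf vp vm)
      (uncoupledModel onsiteChannel neighbourChannel bosonL (convOp (kernelF γf U vp vm))
        (convOp (kernelB γb U vp vm)) sectorPairKinetic (2 * Real.exp (-κ)) hop U) := by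
  intro ψ
  set T := uncoupledModel onsiteChannel neighbourChannel bosonL (convOp (kernelF γf U vp vm))
        (convOp (kernelB γb U vp vm)) sectorPairKinetic (2 * Real.exp (-κ)) hop U with hT
  have hpair : pairPart (T ψ) = (U : ℂ) • adjoint (relativeL 0) (relativeL 0 (pairPart ψ))
      - adjoint (pairFormL κ) (convOp (kernelF γf U vp vm) (pairFormL κ (pairPart ψ)))
      + (hop : ℂ) • pairKinetic (pairPart ψ) := by
    rw [← pairL_apply, ← pairL_apply, hT, uncoupledModel, pairChannel_eq]
    simp only [onsiteChannel, sectorPairKinetic, adjoint_comp, add_apply, sub_apply, smul_apply,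
      comp_apply, map_add, map_sub, map_smul, pairL_adjoint_pairL, pairL_adjoint_bosonL, sub_zero]
  have hboson : bosonPart (T ψ) = -convOp (kernelB γb U vp vm) (bosonPart ψ) := by
    rw [← bosonL_apply, ← bosonL_apply, hT, uncoupledModel, pairChannel_eq]
    simp only [onsiteChannel, sectorPairKinetic, adjoint_comp, add_apply, sub_apply, smul_apply,
      comp_apply, map_add, map_sub, map_smul, bosonL_adjoint_pairL, bosonL_adjoint_bosonL,
      smul_zero, zero_sub, neg_zero, add_zero]
  rw [embed_eq_sectorFn, embed_eq_sectorFn, uncoupledH, effFermionH_sectorFn, fermionH_sectorFn,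
    effBosonH_sectorFn, sectorFn_sub, sectorFn_add, hpair, hboson]
  congr 1
  · funext p
    simp only [lp.coeFn_add, lp.coeFn_sub, lp.coeFn_smul, Pi.add_apply, Pi.sub_apply, Pi.smul_apply,
      smul_eq_mul, adjoint_pairFormL_apply, convOp_apply hf, pairFormL_apply, pairKinetic_apply,
      adjoint_onsite_apply, Pi.zero_apply, add_zero]
    ring
  · funext x
    simp only [lp.coeFn_neg, Pi.add_apply, Pi.neg_apply, convOp_apply hb,
      Pi.zero_apply, sub_zero, zero_add]

end Restriction

end BipolaronModel

/-! ### The theorem for the lattice model. -/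

open BipolaronModel

theorem theorem4p1
    (vp vm : BipolaronModel.Site → ℝ) (hvp : Summable vp) (hvm : Summable vm)
    (hsymm : ∀ x, (vp - vm) (-x) = (vp - vm) x)
    (hrot : ∀ x₁ x₂ : ℤ, (vp - vm) (-x₂, x₁) = (vp - vm) (x₁, x₂))
    (hvp_pos : BipolaronModel.IsPositiveType vp) (hvm_pos : BipolaronModel.IsPositiveType vm)
    (hdisj : ∀ k : ℝ × ℝ, BipolaronModel.fourier vp k * BipolaronModel.fourier vm k = 0)
    (κ hb : ℝ) (hκ : 0 < κ) (hhb : 0 ≤ hb) :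
    ∃ ε₀ : ℝ, 0 < ε₀ ∧ ∃ C : ℝ, ∀ hop U : ℝ, 0 < hop → 0 < U →
      ∃ H Ht : BipolaronModel.Sector →L[ℂ] BipolaronModel.Sector,
        BipolaronModel.IsSectorRestriction
          (BipolaronModel.fullH hop U hb κ (vp - vm)) H ∧
        BipolaronModel.IsSectorRestriction
          (BipolaronModel.uncoupledH hop U κ (2 * Real.exp (-κ)) (2 * Real.exp (-κ))⁻¹ vp vm) Ht ∧
        IsSelfAdjoint H ∧ IsSelfAdjoint Ht ∧
        ∀ ε : ℝ, 0 < ε → ε < ε₀ → ∀ t : ℝ,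
          ‖(BipolaronModel.propagator H t - BipolaronModel.propagator Ht t) ∘L
              BipolaronModel.spectralProjection H (BipolaronModel.groundEnergy H)
                (BipolaronModel.groundEnergy H * (1 - ε))‖
            ≤ C * ((1 + |t|) * (hop + (U ^ 2)⁻¹)) := by
  have hv : Summable (vp - vm) := hvp.sub hvm
  have ha : Summable (vp + vm) := hvp.add hvm
  have hvv : Summable (conv (vp - vm) (vp - vm)) := summable_conv hv hv
  have has (c : ℝ) : Summable (c • (vp + vm)) := ha.const_smul c
  have hvvs (c : ℝ) : Summable (c • conv (vp - vm) (vp - vm)) := hvv.const_smul c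
  have hV : convOp (vp - vm) = convOp vp - convOp vm := repSum_sub norm_shift_le hvp hvm
  have hA : convOp (vp + vm) = convOp vp + convOp vm := repSum_add norm_shift_le hvp hvm
  have h0 : convOp vp * convOp vm = 0 := convOp_mul_eq_zero hvp hvm hdisj
  have h0' : convOp vm * convOp vp = 0 := by rw [convOp_mul_comm hvm hvp, h0]
  have hkB (γ U : ℝ) : kernelB γ U vp vm =
      γ • (vp + vm) + (1 / (2 * U)) • conv (vp - vm) (vp - vm) := rfl
  have hkF (γ U : ℝ) : kernelF γ U vp vm =
      γ • (vp + vm) - (γ ^ 2 / (2 * U + 1)) • conv (vp - vm) (vp - vm) := rfl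
  have hB (γ U : ℝ) : convOp (kernelB γ U vp vm) = (γ : ℂ) • convOp (vp + vm)
      + ((1 / (2 * U) : ℝ) : ℂ) • (convOp (vp - vm) * convOp (vp - vm)) := by
    rw [hkB, ← convOp_conv hv hv, ← convOp_smul, ← convOp_smul]
    exact repSum_add norm_shift_le (has γ) (hvvs _)
  have hF (γ U : ℝ) : convOp (kernelF γ U vp vm) = (γ : ℂ) • convOp (vp + vm)
      - ((γ ^ 2 / (2 * U + 1) : ℝ) : ℂ) • (convOp (vp - vm) * convOp (vp - vm)) := by
    rw [hkF, ← convOp_conv hv hv, ← convOp_smul, ← convOp_smul]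
    exact repSum_sub norm_shift_le (has γ) (hvvs _)
  have hsp := isSelfAdjoint_convOp hvp hvp_pos
  have hsm := isSelfAdjoint_convOp hvm hvm_pos
  obtain ⟨C, hC⟩ := isChannelTriple.exists_norm_propagator_sub_le (V := convOp (vp - vm))
    (A := convOp (vp + vm)) (T := sectorKinetic hb) (T' := sectorPairKinetic)
    (γ := 2 * Real.exp (-κ)) (by positivity) (hV ▸ hsp.sub hsm) (hA ▸ hsp.add hsm)
    (isSelfAdjoint_sectorKinetic hb) isSelfAdjoint_sectorPairKinetic
    (convOp_mul_comm hv ha)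
    -- Disjoint Fourier supports make the cross terms vanish, so the squares of the sum and of the
    -- difference of the two convolutions agree.
    (by rw [hV, hA]; simp [mul_add, add_mul, mul_sub, sub_mul, h0, h0'])
    (fun χ => by
      rw [hA, add_apply, inner_add_right, Complex.add_re]
      exact add_nonneg (re_inner_convOp_nonneg hvp hvp_pos χ) (re_inner_convOp_nonneg hvm hvm_pos χ))
  -- Any `ε₀ < 1` would do; with `1 / 2` the upper edge of the energy window is at most half of a
  -- negative ground energy.
  refine ⟨1 / 2, by norm_num, C, fun hop U hhop hU => ?_⟩
  obtain ⟨h1, h2, h3⟩ := hC hop U hhop hU _ (uncoupledModel onsiteChannel neighbourChannel bosonL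
    (convOp (kernelF (2 * Real.exp (-κ))⁻¹ U vp vm)) (convOp (kernelB (2 * Real.exp (-κ)) U vp vm))
    sectorPairKinetic (2 * Real.exp (-κ)) hop U) rfl (by rw [hB, hF])
  exact ⟨_, _, isSectorRestriction_fullH hv hsymm hop U hb κ,
    isSectorRestriction_uncoupledH ((has _).sub (hvvs _)) ((has _).add (hvvs _)) hop, h1, h2, h3⟩
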